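/- Let $G_0,G_1,\dots,G_r$ be real symmetric $p\times p$ matrices such that $G_1,\dots,G_r$ are linearly independent and $\mathrm{tr}(G_0G_i)=0$ for $i=1,\dots,r$. For $v\in\mathbb{R}^r$ put $\Sigma_v=G_0+\sum_{i=1}^r v_iG_i$, and let $v^*\in\Theta:=\{v\in\mathbb{R}^r:\Sigma_v\succ 0\}$, where $A \succ 0$ means that $A$ is positive definite. Let $X_1,\dots,X_n$ be independent random vectors with distribution $\mathcal{N}_p(\mu,\Sigma_{v^*})$, where $\mu\in\mathbb{R}^p$ is arbitrary, let $\bar X=\frac1n\sum_{i=1}^n X_i$, and let $$S_n=\frac1n\sum_{i=1}^n (X_i-\bar X)(X_i-\bar X)^T$$ be the sample covariance matrix. Let $\Sigma_{\bar v}$ be the least squares estimator, where $\bar v=(G^TG)^{-1}G^T\,\mathrm{vec}(S_n)$ and $G$ is the $p^2\times r$ matrix with columns $\mathrm{vec}(G_1),\dots,\mathrm{vec}(G_r)$. Put $\Delta_{2S_n}=\{v\in\Theta: 0\prec\Sigma_v\prec 2S_n\}$, and let $\kappa=\|\Sigma_{v^*}^{-1}\|\,\|\Sigma_{v^*}\|$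 be the condition number of $\Sigma_{v^*}$ in the spectral norm. Suppose that $n\ge 15$ and $$\epsilon:=\sqrt{\frac{2+\kappa\sqrt p}{1+\kappa\sqrt p}}-\sqrt{\frac{n-1}{n}}-\sqrt{\frac pn}>0.$$ Then $$\mathbb{P}(2S_n-\Sigma_{\bar v}\succ 0)\ \ge\ 1-2\exp(-n\epsilon^2/2),\qquad \mathbb{P}(\Sigma_{\bar v}\succ 0)\ \ge\ 1-2\exp(-n\epsilon^2/2),$$ and consequently $$\mathbb{P}(\bar v\in\Delta_{2S_n})\ \ge\ 1-4\exp(-n\epsilon^2/2).$$ -/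

import Mathlib

open MeasureTheory ProbabilityTheory

namespace LinearGaussianCov

/-- The matrix `Σ_v = G₀ + ∑ i, v i • G i` of a linear covariance model. -/
def modelCov {p r : ℕ} (G₀ : Matrix (Fin p) (Fin p) ℝ) (G : Fin r → Matrix (Fin p) (Fin p) ℝ)
    (v : Fin r → ℝ) : Matrix (Fin p) (Fin p) ℝ :=
  G₀ + ∑ i, v i • G i

/-- The parameter space `Θ_G = {v | Σ_v ≻ 0}`. -/
def paramSpace {p r : ℕ} (G₀ : Matrix (Fin p) (Fin p) ℝ) (G : Fin r → Matrix (Fin p) (Fin p) ℝ) :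
    Set (Fin r → ℝ) :=
  {v | (modelCov G₀ G v).PosDef}

/-- The region `Δ_{2S} = {v ∈ Θ_G | 0 ≺ Σ_v ≺ 2S}`. -/
def convexRegion {p r : ℕ} (G₀ : Matrix (Fin p) (Fin p) ℝ)
    (G : Fin r → Matrix (Fin p) (Fin p) ℝ) (S : Matrix (Fin p) (Fin p) ℝ) : Set (Fin r → ℝ) :=
  {v | v ∈ paramSpace G₀ G ∧ (modelCov G₀ G v).PosDef ∧
    ((2 : ℝ) • S - modelCov G₀ G v).PosDef}

/-- The sample mean `n⁻¹ ∑ i, x i`. -/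
noncomputable def sampleMean {n p : ℕ} (x : Fin n → EuclideanSpace ℝ (Fin p)) :
    EuclideanSpace ℝ (Fin p) :=
  (n : ℝ)⁻¹ • ∑ i, x i

/-- The sample covariance matrix `n⁻¹ ∑ i, (x i - x̄) (x i - x̄)ᵀ`. -/
noncomputable def sampleCov {n p : ℕ} (x : Fin n → EuclideanSpace ℝ (Fin p)) :
    Matrix (Fin p) (Fin p) ℝ :=
  (n : ℝ)⁻¹ • ∑ i, Matrix.vecMulVec (x i - sampleMean x).ofLp (x i - sampleMean x).ofLp

/-- The `p² × r` matrix whose columns are `vec (G 1), …, vec (G r)`. -/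
def designMatrix {p r : ℕ} (G : Fin r → Matrix (Fin p) (Fin p) ℝ) :
    Matrix (Fin p × Fin p) (Fin r) ℝ :=
  Matrix.of fun ab i => (G i).vec ab

/-- The least squares estimator `v̄ = (𝐆ᵀ𝐆)⁻¹ 𝐆ᵀ vec S`, where `𝐆` is the design matrix.
For linearly independent `G i` it is the unique solution of the normal equations
`∑ i, v i * tr (G i * G j) = tr (S * G j)`. -/
noncomputable def leastSquares {p r : ℕ} (G : Fin r → Matrix (Fin p) (Fin p) ℝ)
    (S : Matrix (Fin p) (Fin p) ℝ) : Fin r → ℝ :=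
  Matrix.mulVec ((designMatrix G).transpose * designMatrix G)⁻¹
    (Matrix.mulVec (designMatrix G).transpose S.vec)

/-- The spectral norm, i.e. the operator norm with respect to Euclidean norms. -/
noncomputable def spectralNorm {p : ℕ} (A : Matrix (Fin p) (Fin p) ℝ) : ℝ :=
  ‖Matrix.toEuclideanCLM (n := Fin p) (𝕜 := ℝ) A‖

/-- The condition number `‖A⁻¹‖ ‖A‖` in the spectral norm. -/
noncomputable def condNumber {p : ℕ} (A : Matrix (Fin p) (Fin p) ℝ) : ℝ :=
  spectralNorm A⁻¹ * spectralNorm A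

/-- `√((2 + κ√p) / (1 + κ√p)) - √((n - 1) / n) - √(p / n)`. -/
noncomputable def epsBound (n p : ℕ) (κ : ℝ) : ℝ :=
  √((2 + κ * √(p : ℝ)) / (1 + κ * √(p : ℝ))) - √(((n : ℝ) - 1) / n) - √((p : ℝ) / n)

end LinearGaussianCov

/-!
The least squares estimator and its residual are governed by one quantity: the relative deviation
of the sample covariance matrix `S` from the true covariance matrix `Σ`. Put `T = κ √p` and
`x = 1 / (1 + T)`, and suppose that `(1 - x) Σ ≺ S ≼ (1 + x) Σ` as quadratic forms. Then
`‖S - Σ‖ ≤ x ‖Σ‖`, so the Frobenius norm of `S - Σ` is at most `x √p ‖Σ‖`. By the normal equations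
and `tr (G₀ Gᵢ) = 0`, the error `Σ_v̄ - Σ` and the residual `S - Σ_v̄` are orthogonal, and both are
therefore at most `x √p ‖Σ‖` in Frobenius norm; relative to `Σ ≽ ‖Σ⁻¹‖⁻¹` this is `x T = 1 - x`.
Hence `Σ_v̄ ≽ Σ - (1 - x) Σ = x Σ ≻ 0` and `2 S - Σ_v̄ = S + (S - Σ_v̄) ≻ (1 - x) Σ - (1 - x) Σ = 0`
(`posDef_of_quadraticForm_bounds`).

It remains to bound the probability of the two-sided estimate. Whitening the sample
(`exists_whitening`) turns it into a statement about the extreme values of `‖A u‖` on the unit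
sphere, where `A` is the standard Gaussian matrix of size `(n - 1) × p` obtained by projecting the
columns of the sample matrix onto the vectors with zero coordinate sum. To avoid choosing a basis of
that hyperplane, `A u` is written as `frameMap q u`, with `q` the projection of the standard basis,
which is a Parseval frame. The thresholds to be compared with are `√(n - 1) ± (√p + t)`, where
`t = √n ε`: by the definition of `ε` the upper one equals `√n √(1 + x)`, and `0 < ε` implies that the
lower one exceeds `√n √(1 - x)` (`sqrt_mul_sqrt_lt`).

The tails `exp (-t² / 2)` come from Gordon's comparison of the Gaussian processes `(A u, γ)` and
`(h, ⟪u, g⟫)` in `ℝⁿ⁻¹ × ℝ`, with `γ`, `h`, `g` independent and standard Gaussian. It is applied in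
exponential form, to a smooth version of `exp (t · max_u (‖z u‖ + s u))` and of
`exp (-t · min_u (‖z u‖ + s u))` (`integral_gordonFun_le`), where the scalar `γ` contributes the
factor `exp (t² / 2)`. Together with
`𝔼 exp (t ‖g‖) ≤ exp (t √d + t² / 2)` and `𝔼 exp (-t ‖h‖) ≤ exp (-t √d + t² / 2)` this gives exactly
the required tails by Markov's inequality, without a separate concentration argument. The lower
exponential moment bound holds for dimension `d ≥ 14` and `t ≥ 1`
(`integral_exp_neg_mul_norm_le`), which is where `n ≥ 15` enters; for `t < 1` the claimed
probabilities are bounded below by negative numbers. Both exponential moment bounds follow from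
differential inequalities for the moment generating function of the norm, derived from Stein's
identity and the Cauchy–Schwarz inequality.
-/

open scoped RealInnerProductSpace Matrix

namespace LinearGaussianCov

/-! ### Integration by parts for the standard Gaussian measure -/

section StandardGaussian

variable {E : Type*} [NormedAddCommGroup E] [InnerProductSpace ℝ E] [FiniteDimensional ℝ E]
  [MeasurableSpace E] [BorelSpace E]

/-- The Lebesgue density of the standard Gaussian measure. -/
noncomputable def stdGaussianPDF (E : Type*) [NormedAddCommGroup E] [InnerProductSpace ℝ E]
    (x : E) : ℝ :=
  (2 * Real.pi) ^ (-(Module.finrank ℝ E / 2 : ℝ)) * Real.exp (-(1 / 2) * ‖x‖ ^ 2)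

omit [FiniteDimensional ℝ E] [MeasurableSpace E] [BorelSpace E] in
lemma stdGaussianPDF_nonneg (x : E) : 0 ≤ stdGaussianPDF E x := by
  unfold stdGaussianPDF; positivity

omit [FiniteDimensional ℝ E] [MeasurableSpace E] [BorelSpace E] in
@[fun_prop]
lemma continuous_stdGaussianPDF : Continuous (stdGaussianPDF E) := by
  unfold stdGaussianPDF; fun_prop

lemma integrable_stdGaussianPDF : Integrable (stdGaussianPDF E) := by
  have h := (GaussianFourier.integrable_cexp_neg_mul_sq_norm_add (V := E) (b := (1 / 2 : ℂ))
    (by norm_num) 0 0).norm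
  refine (h.const_mul ((2 * Real.pi) ^ (-(Module.finrank ℝ E / 2 : ℝ)))).congr
    (Filter.Eventually.of_forall fun x => ?_)
  simp only [stdGaussianPDF, Complex.norm_exp]
  congr 2
  simp [← Complex.ofReal_pow]

lemma stdGaussian_eq_withDensity :
    stdGaussian E = (volume : Measure E).withDensity
      (fun x => ENNReal.ofReal (stdGaussianPDF E x)) := by
  have : IsFiniteMeasure ((volume : Measure E).withDensity
      (fun x => ENNReal.ofReal (stdGaussianPDF E x))) :=
    isFiniteMeasure_withDensity_ofReal integrable_stdGaussianPDF.2
  refine Measure.ext_of_charFun ?_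
  ext t
  rw [charFun_stdGaussian, charFun_apply,
    integral_withDensity_eq_integral_toReal_smul (by fun_prop) (by simp)]
  have h := GaussianFourier.integral_cexp_neg_mul_sq_norm_add (V := E) (b := (1 / 2 : ℂ))
    (by norm_num) Complex.I t
  have e : ∀ x : E, (ENNReal.ofReal (stdGaussianPDF E x)).toReal • Complex.exp (⟪x, t⟫ * Complex.I)
      = (((2 * Real.pi) ^ (-(Module.finrank ℝ E / 2 : ℝ)) : ℝ) : ℂ) *
        Complex.exp (-(1 / 2 : ℂ) * ‖x‖ ^ 2 + Complex.I * ⟪t, x⟫) := by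
    intro x
    rw [ENNReal.toReal_ofReal (stdGaussianPDF_nonneg x), stdGaussianPDF, Complex.exp_add,
      real_inner_comm, mul_comm Complex.I]
    simp only [Complex.real_smul]
    push_cast
    ring
  simp_rw [e]
  rw [integral_const_mul, h]
  have h2 : ((2 * Real.pi : ℝ) : ℂ) ^ (Module.finrank ℝ E / 2 : ℂ)
      = (((2 * Real.pi) ^ (Module.finrank ℝ E / 2 : ℝ) : ℝ) : ℂ) := by
    rw [Complex.ofReal_cpow (by positivity)]; push_cast; rfl
  have h3 : (Real.pi : ℂ) / (1 / 2) = ((2 * Real.pi : ℝ) : ℂ) := by push_cast; ring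
  rw [h3, h2, Real.rpow_neg (by positivity), ← mul_assoc, ← Complex.ofReal_mul,
    inv_mul_cancel₀ (by positivity)]
  simp only [Complex.ofReal_one, one_mul, Complex.I_sq]
  congr 1
  ring

lemma integral_stdGaussian (f : E → ℝ) :
    ∫ x, f x ∂stdGaussian E = ∫ x, f x * stdGaussianPDF E x := by
  rw [stdGaussian_eq_withDensity,
    integral_withDensity_eq_integral_toReal_smul (by fun_prop) (by simp)]
  refine integral_congr_ae (Filter.Eventually.of_forall fun x => ?_)
  simp [ENNReal.toReal_ofReal (stdGaussianPDF_nonneg x), mul_comm]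

lemma integrable_stdGaussian_iff (f : E → ℝ) :
    Integrable f (stdGaussian E) ↔ Integrable (fun x => f x * stdGaussianPDF E x) := by
  rw [stdGaussian_eq_withDensity,
    integrable_withDensity_iff (by fun_prop) (by simp)]
  simp [ENNReal.toReal_ofReal (stdGaussianPDF_nonneg _)]

/-- Gaussian integration by parts (Stein's identity) in the direction `v`. -/
lemma integral_inner_mul_stdGaussian {f f' : E → ℝ} (v : E)
    (hf : ∀ x, HasLineDerivAt ℝ f (f' x) x v)
    (hfi : Integrable f (stdGaussian E)) (hfi' : Integrable f' (stdGaussian E))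
    (hvf : Integrable (fun x => ⟪x, v⟫ * f x) (stdGaussian E)) :
    ∫ x, ⟪x, v⟫ * f x ∂stdGaussian E = ∫ x, f' x ∂stdGaussian E := by
  have hg : ∀ x : E, HasLineDerivAt ℝ (stdGaussianPDF E) (-⟪x, v⟫ * stdGaussianPDF E x) x v := by
    intro x
    have h1 : HasFDerivAt (fun y : E => ‖y‖ ^ 2) (2 • innerSL ℝ x) x :=
      (hasStrictFDerivAt_norm_sq x).hasFDerivAt
    have h2 := ((h1.const_mul (-(1 / 2 : ℝ))).exp.const_mul
      ((2 * Real.pi) ^ (-(Module.finrank ℝ E / 2 : ℝ)))).hasLineDerivAt v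
    convert! h2 using 1
    simp [stdGaussianPDF]
    ring
  rw [integrable_stdGaussian_iff] at hfi hfi' hvf
  have key := integral_bilinear_hasLineDerivAt_right_eq_neg_left_of_integrable
    (μ := (volume : Measure E)) (f := f) (f' := f') (g := stdGaussianPDF E)
    (g' := fun x => -⟪x, v⟫ * stdGaussianPDF E x) (v := v)
    (B := ContinuousLinearMap.mul ℝ ℝ) (by simpa using hfi')
    (by
      refine hvf.neg.congr (Filter.Eventually.of_forall fun x => ?_)
      simp; ring)
    (by simpa using hfi) (fun x _ => hf x) (fun x _ => hg x)
  rw [integral_stdGaussian, integral_stdGaussian]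
  simp only [ContinuousLinearMap.mul_apply'] at key
  rw [← neg_eq_iff_eq_neg, ← integral_neg] at key
  rw [← key]
  exact integral_congr_ae (Filter.Eventually.of_forall fun x => by simp; ring)

lemma integrable_exp_mul_norm_stdGaussian (K : ℝ) :
    Integrable (fun x : E => Real.exp (K * ‖x‖)) (stdGaussian E) := by
  obtain ⟨C, hC, hi⟩ := IsGaussian.exists_integrable_exp_sq (stdGaussian E)
  refine (hi.const_mul (Real.exp (K ^ 2 / (4 * C)))).mono' (by fun_prop)
    (Filter.Eventually.of_forall fun x => ?_)
  rw [Real.norm_of_nonneg (by positivity), ← Real.exp_add, Real.exp_le_exp]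
  have : K ^ 2 / (4 * C) + C * ‖x‖ ^ 2 - K * ‖x‖ = (K - 2 * C * ‖x‖) ^ 2 / (4 * C) := by
    field_simp; ring
  have h2 : 0 ≤ (K - 2 * C * ‖x‖) ^ 2 / (4 * C) := by positivity
  linarith

/-- A measurable function of at most exponential growth is Gaussian integrable. -/
lemma integrable_stdGaussian_of_le_exp {f : E → ℝ} (hf : AEStronglyMeasurable f (stdGaussian E))
    (C K : ℝ) (h : ∀ x, |f x| ≤ C * Real.exp (K * ‖x‖)) : Integrable f (stdGaussian E) :=
  ((integrable_exp_mul_norm_stdGaussian K).const_mul C).mono' hf (Filter.Eventually.of_forall h)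

lemma integrable_norm_pow_mul_exp_stdGaussian (k : ℕ) (t : ℝ) :
    Integrable (fun x : E => ‖x‖ ^ k * Real.exp (t * ‖x‖)) (stdGaussian E) := by
  refine integrable_stdGaussian_of_le_exp (by fun_prop) (k.factorial) (1 + t) fun x => ?_
  rw [abs_of_nonneg (by positivity), add_mul, one_mul, Real.exp_add, ← mul_assoc]
  gcongr
  have := Real.pow_div_factorial_le_exp ‖x‖ (norm_nonneg _) k
  rwa [div_le_iff₀' (by positivity)] at this

/-- Stein's identity for the radial vector field `x ↦ ψ ‖x‖ • x`. -/
lemma integral_norm_sq_mul_stdGaussian {ψ ψ' : ℝ → ℝ} (hψ : ∀ r, HasDerivAt ψ (ψ' r) r)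
    (hψ' : Continuous ψ')
    (h0 : Integrable (fun x : E => ψ ‖x‖) (stdGaussian E))
    (h1 : Integrable (fun x : E => ‖x‖ * ψ ‖x‖) (stdGaussian E))
    (h2 : Integrable (fun x : E => ‖x‖ ^ 2 * ψ ‖x‖) (stdGaussian E))
    (h3 : Integrable (fun x : E => ‖x‖ * ψ' ‖x‖) (stdGaussian E)) :
    ∫ x : E, ‖x‖ ^ 2 * ψ ‖x‖ ∂stdGaussian E =
      Module.finrank ℝ E * ∫ x : E, ψ ‖x‖ ∂stdGaussian E + ∫ x : E, ‖x‖ * ψ' ‖x‖ ∂stdGaussian E := by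
  have hψc : Continuous ψ := continuous_iff_continuousAt.2 fun r => (hψ r).continuousAt
  set b := stdOrthonormalBasis ℝ E with hb
  have hbn : ∀ i, ‖b i‖ = 1 := fun i => b.orthonormal.1 i
  have hin : ∀ x i, |⟪x, b i⟫| ≤ ‖x‖ := fun x i => by
    simpa [hbn i] using abs_real_inner_le_norm x (b i)
  have hd : ∀ i (x : E), HasLineDerivAt ℝ (fun x : E => ⟪x, b i⟫ * ψ ‖x‖)
      (ψ ‖x‖ + ⟪x, b i⟫ ^ 2 / ‖x‖ * ψ' ‖x‖) x (b i) := by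
    intro i x
    unfold HasLineDerivAt
    have hl : HasDerivAt (fun t : ℝ => ⟪x + t • b i, b i⟫) 1 0 := by
      simp only [inner_add_left, real_inner_smul_left, real_inner_self_eq_norm_sq, hbn]
      simpa using (hasDerivAt_id (0 : ℝ)).const_add (⟪x, b i⟫)
    rcases eq_or_ne x 0 with rfl | hx
    · -- the norm is not differentiable at the origin, but there the linear factor vanishes
      simp only [zero_add, real_inner_smul_left, real_inner_self_eq_norm_sq, hbn, norm_zero,
        div_zero, zero_mul, add_zero, norm_smul, Real.norm_eq_abs]
      rw [hasDerivAt_iff_tendsto_slope]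
      have : Filter.Tendsto (fun t : ℝ => ψ |t|) (nhdsWithin 0 {0}ᶜ) (nhds (ψ 0)) := by
        have : Continuous fun t : ℝ => ψ |t| := by fun_prop
        simpa using this.continuousAt.tendsto.mono_left (nhdsWithin_le_nhds (a := (0 : ℝ)))
      refine this.congr' ?_
      filter_upwards [self_mem_nhdsWithin] with t ht
      have ht : t ≠ 0 := ht
      simp [slope_def_field, ht]
    · have hn : HasDerivAt (fun t : ℝ => ‖x + t • b i‖) (⟪x, b i⟫ / ‖x‖) 0 := by
        have hsq : HasDerivAt (fun t : ℝ => ‖x + t • b i‖ ^ 2) (2 * ⟪x, b i⟫) 0 := by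
          have : HasDerivAt (fun t : ℝ => x + t • b i) (b i) 0 := by
            simpa using ((hasDerivAt_id (0 : ℝ)).smul_const (b i)).const_add x
          simpa using this.norm_sq
        have hpos : 0 < ‖x‖ := norm_pos_iff.2 hx
        have := hsq.sqrt (by simpa using hpos.ne')
        simp only [Real.sqrt_sq (norm_nonneg _)] at this
        convert this using 1
        simp
        field_simp
      have hc := HasDerivAt.comp (h₂ := ψ) (0 : ℝ) (by simpa using hψ ‖x‖) hn
      convert! hl.mul hc using 1
      simp
      ring
  have hi2 : ∀ i, Integrable (fun x : E => ⟪x, b i⟫ ^ 2 / ‖x‖ * ψ' ‖x‖) (stdGaussian E) := by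
    intro i
    refine h3.abs.mono' (Measurable.aestronglyMeasurable (by fun_prop))
      (Filter.Eventually.of_forall fun x => ?_)
    rw [Real.norm_eq_abs, abs_mul, abs_mul, abs_norm, abs_of_nonneg (by positivity)]
    gcongr
    rcases eq_or_ne x 0 with rfl | hx
    · simp
    · rw [div_le_iff₀ (norm_pos_iff.2 hx), ← sq, ← sq_abs]
      exact pow_le_pow_left₀ (abs_nonneg _) (hin x i) 2
  have hi1 : ∀ i, Integrable (fun x : E => ⟪x, b i⟫ * (⟪x, b i⟫ * ψ ‖x‖)) (stdGaussian E) := by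
    intro i
    refine h2.abs.mono' (by fun_prop) (Filter.Eventually.of_forall fun x => ?_)
    rw [Real.norm_eq_abs, ← mul_assoc, abs_mul, abs_mul, abs_mul, sq, abs_mul, abs_norm]
    gcongr <;> exact hin x i
  have hI : ∀ i, ∫ x : E, ⟪x, b i⟫ * (⟪x, b i⟫ * ψ ‖x‖) ∂stdGaussian E =
      ∫ x : E, ψ ‖x‖ ∂stdGaussian E + ∫ x : E, ⟪x, b i⟫ ^ 2 / ‖x‖ * ψ' ‖x‖ ∂stdGaussian E := by
    intro i
    rw [integral_inner_mul_stdGaussian (b i) (hd i) _ (h0.add (hi2 i)) (hi1 i),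
      integral_add h0 (hi2 i)]
    refine h1.abs.mono' (by fun_prop) (Filter.Eventually.of_forall fun x => ?_)
    rw [Real.norm_eq_abs, abs_mul, abs_mul, abs_norm]
    gcongr
    exact hin x i
  have hsum : ∀ x : E, ∑ i, ⟪x, b i⟫ ^ 2 = ‖x‖ ^ 2 := b.sum_sq_inner_left
  calc _ = ∫ x : E, ∑ i, ⟪x, b i⟫ * (⟪x, b i⟫ * ψ ‖x‖) ∂stdGaussian E := by
        congr 1; ext x; rw [← hsum, Finset.sum_mul]; congr 1; ext i; ring
    _ = ∑ i, (∫ x : E, ψ ‖x‖ ∂stdGaussian E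
          + ∫ x : E, ⟪x, b i⟫ ^ 2 / ‖x‖ * ψ' ‖x‖ ∂stdGaussian E) := by
        rw [integral_finsetSum _ fun i _ => hi1 i]; simp_rw [hI]
    _ = _ := by
        rw [Finset.sum_add_distrib, ← integral_finsetSum _ fun i _ => hi2 i]
        simp only [Finset.sum_const, Finset.card_univ, Fintype.card_fin, nsmul_eq_mul]
        congr 2; ext x
        rw [← Finset.sum_mul, ← Finset.sum_div, hsum]
        rcases eq_or_ne x 0 with rfl | hx
        · simp
        · have := norm_pos_iff.2 hx
          field_simp

end StandardGaussian

/-! ### The moment generating function of the Gaussian norm -/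

section NormMgf

variable (E : Type*) [NormedAddCommGroup E] [InnerProductSpace ℝ E] [FiniteDimensional ℝ E]
  [MeasurableSpace E] [BorelSpace E]

/-- The exponentially tilted moment `𝔼 [‖x‖ ^ k * exp (t * ‖x‖)]` of a standard Gaussian vector. -/
noncomputable def normMoment (k : ℕ) (t : ℝ) : ℝ :=
  ∫ x : E, ‖x‖ ^ k * Real.exp (t * ‖x‖) ∂stdGaussian E

omit [BorelSpace E] in
lemma normMoment_nonneg (k : ℕ) (t : ℝ) : 0 ≤ normMoment E k t :=
  integral_nonneg fun x => by positivity

lemma normMoment_zero_pos (t : ℝ) : 0 < normMoment E 0 t := by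
  simpa [normMoment] using integral_exp_pos (integrable_exp_mul_norm_stdGaussian (E := E) t)

lemma normMoment_zero_zero : normMoment E 0 0 = 1 := by simp [normMoment]

lemma hasDerivAt_normMoment_zero (t : ℝ) :
    HasDerivAt (normMoment E 0) (normMoment E 1 t) t := by
  have h : t ∈ interior (integrableExpSet (fun x : E => ‖x‖) (stdGaussian E)) := by
    have : integrableExpSet (fun x : E => ‖x‖) (stdGaussian E) = Set.univ :=
      Set.eq_univ_of_forall fun s => integrable_exp_mul_norm_stdGaussian s
    simp [this]
  have e : normMoment E 0 = mgf (fun x : E => ‖x‖) (stdGaussian E) := by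
    ext s; simp [normMoment, mgf]
  rw [e]
  simpa [normMoment] using hasDerivAt_mgf h

lemma normMoment_two (t : ℝ) :
    normMoment E 2 t = Module.finrank ℝ E * normMoment E 0 t + t * normMoment E 1 t := by
  have hi := fun k => integrable_norm_pow_mul_exp_stdGaussian (E := E) k t
  have h := integral_norm_sq_mul_stdGaussian (E := E) (ψ := fun r => Real.exp (t * r))
    (ψ' := fun r => Real.exp (t * r) * t)
    (fun r => by simpa using ((hasDerivAt_id r).const_mul t).exp) (by fun_prop)
    (by simpa using hi 0) (by simpa using hi 1) (hi 2)
    (((hi 1).mul_const t).congr (Filter.Eventually.of_forall fun x => by simp; ring))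
  rw [normMoment, h]
  simp only [normMoment, pow_zero, one_mul, pow_one, ← integral_const_mul]
  congr 2
  ext x; ring

lemma normMoment_three (t : ℝ) :
    normMoment E 3 t = (Module.finrank ℝ E + 1) * normMoment E 1 t + t * normMoment E 2 t := by
  have hi := fun k => integrable_norm_pow_mul_exp_stdGaussian (E := E) k t
  have h := integral_norm_sq_mul_stdGaussian (E := E) (ψ := fun r => r * Real.exp (t * r))
    (ψ' := fun r => Real.exp (t * r) + r * (Real.exp (t * r) * t))
    (fun r => by
      convert! (hasDerivAt_id r).mul ((hasDerivAt_id r).const_mul t).exp using 1; simp) (by fun_prop)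
    (by simpa using hi 1)
    ((hi 2).congr (Filter.Eventually.of_forall fun x => by simp; ring))
    ((hi 3).congr (Filter.Eventually.of_forall fun x => by simp; ring))
    (((hi 1).add ((hi 2).mul_const t)).congr (Filter.Eventually.of_forall fun x => by simp; ring))
  have e3 : normMoment E 3 t = ∫ x : E, ‖x‖ ^ 2 * (‖x‖ * Real.exp (t * ‖x‖)) ∂stdGaussian E := by
    rw [normMoment]; congr 1; ext x; ring
  have e : ∫ x : E, ‖x‖ * (Real.exp (t * ‖x‖) + ‖x‖ * (Real.exp (t * ‖x‖) * t)) ∂stdGaussian E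
      = normMoment E 1 t + t * normMoment E 2 t := by
    rw [normMoment, normMoment, ← integral_const_mul, ← integral_add (hi 1) ((hi 2).const_mul t)]
    congr 1; ext x; ring
  rw [e3, h, e]
  simp only [normMoment, pow_one]
  ring

/-- Log-convexity of the tilted moments, by the Cauchy–Schwarz inequality. -/
lemma normMoment_succ_sq_le (k : ℕ) (t : ℝ) (hk : 0 < normMoment E k t) :
    normMoment E (k + 1) t ^ 2 ≤ normMoment E k t * normMoment E (k + 2) t := by
  have hi := fun k => integrable_norm_pow_mul_exp_stdGaussian (E := E) k t
  set A := normMoment E (k + 1) t with hA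
  set B := normMoment E k t with hB
  have h : 0 ≤ ∫ x : E, (A - B * ‖x‖) ^ 2 * (‖x‖ ^ k * Real.exp (t * ‖x‖)) ∂stdGaussian E :=
    integral_nonneg fun x => by positivity
  have e : ∫ x : E, (A - B * ‖x‖) ^ 2 * (‖x‖ ^ k * Real.exp (t * ‖x‖)) ∂stdGaussian E =
      A ^ 2 * B - 2 * A * B * A + B ^ 2 * normMoment E (k + 2) t := by
    have e1 : ∀ x : E, (A - B * ‖x‖) ^ 2 * (‖x‖ ^ k * Real.exp (t * ‖x‖)) =
        A ^ 2 * (‖x‖ ^ k * Real.exp (t * ‖x‖)) - 2 * A * B * (‖x‖ ^ (k + 1) * Real.exp (t * ‖x‖))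
          + B ^ 2 * (‖x‖ ^ (k + 2) * Real.exp (t * ‖x‖)) := fun x => by ring
    simp_rw [e1]
    have h12 : Integrable (fun x : E => A ^ 2 * (‖x‖ ^ k * Real.exp (t * ‖x‖)) -
        2 * A * B * (‖x‖ ^ (k + 1) * Real.exp (t * ‖x‖))) (stdGaussian E) :=
      ((hi k).const_mul _).sub ((hi (k + 1)).const_mul _)
    rw [integral_add h12 ((hi (k + 2)).const_mul _),
      integral_sub ((hi k).const_mul _) ((hi (k + 1)).const_mul _),
      integral_const_mul, integral_const_mul, integral_const_mul]
    rfl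
  rw [e] at h
  have : 0 ≤ B * (B * normMoment E (k + 2) t - A ^ 2) := by linarith
  have := nonneg_of_mul_nonneg_right this hk
  linarith

/-- The mean of the tilted norm is at most `√d + t`. -/
lemma normMoment_one_le (t : ℝ) (ht : 0 ≤ t) :
    normMoment E 1 t ≤ (√(Module.finrank ℝ E) + t) * normMoment E 0 t := by
  have h0 := normMoment_zero_pos E t
  have hcs := normMoment_succ_sq_le E 0 t h0
  simp only [zero_add] at hcs
  rw [normMoment_two] at hcs
  set s := √(Module.finrank ℝ E : ℝ) with hs
  have hd : (Module.finrank ℝ E : ℝ) = s ^ 2 := by rw [hs, Real.sq_sqrt (by positivity)]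
  have hs0 : 0 ≤ s := Real.sqrt_nonneg _
  rw [hd] at hcs
  by_contra! hlt
  set A := normMoment E 0 t
  set B := normMoment E 1 t
  have h1 : s * A < B - t * A := by linarith
  have h2 : 0 ≤ s * A := by positivity
  have h3 : 0 < B := by
    have : 0 ≤ t * A := by positivity
    linarith
  nlinarith [mul_lt_mul_of_pos_left h1 h3, mul_nonneg hs0 ht, mul_nonneg h2 (mul_nonneg ht h0.le)]

/-- The mean of the norm under a negative tilt is at least `d / √(d + 1) - d / (d + 1) * s / 2`. -/
lemma le_normMoment_one (s : ℝ) (hs : 0 ≤ s) :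
    (Module.finrank ℝ E / √(Module.finrank ℝ E + 1) -
        Module.finrank ℝ E / (Module.finrank ℝ E + 1) * s / 2) * normMoment E 0 (-s) ≤
      normMoment E 1 (-s) := by
  have h0 := normMoment_zero_pos E (-s)
  have h1 := normMoment_nonneg E 1 (-s)
  have e2 := normMoment_two E (-s)
  have e3 := normMoment_three E (-s)
  set A := normMoment E 0 (-s)
  set B := normMoment E 1 (-s)
  set V := normMoment E 2 (-s)
  set d : ℝ := (Module.finrank ℝ E : ℝ) with hd
  have hd0 : 0 ≤ d := by positivity
  set q := √(d + 1) with hq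
  have hq2 : q ^ 2 = d + 1 := Real.sq_sqrt (by positivity)
  have hq0 : 0 < q := Real.sqrt_pos.2 (by positivity)
  -- the quadratic inequality satisfied by the tilted mean `B / A`
  have key : d * A * (d * A - s * B) ≤ (d + 1) * B ^ 2 := by
    rcases h1.eq_or_lt with hB | hB
    · have hcs := normMoment_succ_sq_le E 0 (-s) h0
      have hV : V = d * A := by rw [e2, ← hB]; ring
      have h4 := integrable_norm_pow_mul_exp_stdGaussian (E := E) 1 (-s)
      -- a vanishing first moment forces the norm to vanish almost surely
      have hz : ∀ᵐ x ∂stdGaussian E, ‖x‖ ^ 1 * Real.exp (-s * ‖x‖) = 0 :=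
        (integral_eq_zero_iff_of_nonneg (fun x => by positivity) h4).1 hB.symm
      have hV0 : V = 0 := by
        refine integral_eq_zero_of_ae ?_
        filter_upwards [hz] with x hx
        have : ‖x‖ = 0 := by simpa using hx
        simp [this]
      rw [← hB]
      have : d * A = 0 := by rw [← hV, hV0]
      rw [this]; simp
    · have hcs := normMoment_succ_sq_le E 1 (-s) hB
      have hV : V ^ 2 ≤ B * ((d + 1) * B + -s * V) := by rw [← e3]; exact hcs
      have : d * A = V + s * B := by rw [e2]; ring
      rw [this]; nlinarith
  by_contra! hlt
  have ha : d / q * A - d / (d + 1) * s / 2 * A > B := by linarith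
  have h5 : B * q ^ 2 + d * s / 2 * A < d * q * A := by
    have : d / q * A - d / (d + 1) * s / 2 * A = (d * q * A - d * s / 2 * A) / q ^ 2 := by
      rw [← hq2]; field_simp
    rw [this, gt_iff_lt, lt_div_iff₀ (by positivity)] at ha
    linarith
  have h6 : (B * q ^ 2 + d * s / 2 * A) ^ 2 < (d * q * A) ^ 2 :=
    pow_lt_pow_left₀ h5 (by positivity) two_ne_zero
  have h7 : 0 ≤ (d * s / 2 * A) ^ 2 := sq_nonneg _
  have h8 : q ^ 2 * (d * A * (d * A - s * B)) ≤ q ^ 2 * (q ^ 2 * B ^ 2) := by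
    rw [← hq2] at key; exact mul_le_mul_of_nonneg_left key (by positivity)
  nlinarith

/-- Upper exponential moments of the norm of a standard Gaussian vector. -/
lemma integral_exp_mul_norm_le (t : ℝ) (ht : 0 ≤ t) :
    ∫ x : E, Real.exp (t * ‖x‖) ∂stdGaussian E ≤
      Real.exp (t * √(Module.finrank ℝ E) + t ^ 2 / 2) := by
  set a := √(Module.finrank ℝ E : ℝ)
  have hd : ∀ t, HasDerivAt (fun t => normMoment E 0 t * Real.exp (-(t * a + t ^ 2 / 2)))
      ((normMoment E 1 t - (a + t) * normMoment E 0 t) * Real.exp (-(t * a + t ^ 2 / 2))) t := by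
    intro t
    have h1 : HasDerivAt (fun t : ℝ => -(t * a + t ^ 2 / 2)) (-(a + t)) t := by
      have := (((hasDerivAt_id t).mul_const a).add (((hasDerivAt_id t).pow 2).div_const 2)).neg
      convert! this using 1; simp
    convert! (hasDerivAt_normMoment_zero E t).mul h1.exp using 1
    ring
  have hanti : AntitoneOn (fun t => normMoment E 0 t * Real.exp (-(t * a + t ^ 2 / 2)))
      (Set.Ici 0) := by
    refine antitoneOn_of_deriv_nonpos (convex_Ici 0)
      (fun x _ => (hd x).continuousAt.continuousWithinAt)
      (fun x _ => (hd x).differentiableAt.differentiableWithinAt) fun x hx => ?_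
    rw [(hd x).deriv]
    simp only [interior_Ici, Set.mem_Ioi] at hx
    exact mul_nonpos_of_nonpos_of_nonneg (by linarith [normMoment_one_le E x hx.le])
      (Real.exp_nonneg _)
  have := hanti (Set.mem_Ici.2 le_rfl) (Set.mem_Ici.2 ht) ht
  simp only [normMoment_zero_zero, Real.exp_neg, zero_mul] at this
  rw [← div_eq_mul_inv, div_le_iff₀ (by positivity)] at this
  simpa [normMoment] using this

/-- Lower exponential moments of the norm of a standard Gaussian vector. As `𝔼 ‖x‖ < √d`, a bound
with `√d` in the exponent fails for small `s`; for `s ≥ 1` the deficit is absorbed because the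
variance of the norm is only about `1 / 2`. -/
lemma integral_exp_neg_mul_norm_le (hdim : 14 ≤ Module.finrank ℝ E) (s : ℝ) (hs : 1 ≤ s) :
    ∫ x : E, Real.exp (-s * ‖x‖) ∂stdGaussian E ≤
      Real.exp (-s * √(Module.finrank ℝ E) + s ^ 2 / 2) := by
  have hbd := le_normMoment_one E
  have hdim' : (14 : ℝ) ≤ (Module.finrank ℝ E : ℝ) := by exact_mod_cast hdim
  set d : ℝ := (Module.finrank ℝ E : ℝ) with hdd
  set a := d / √(d + 1) with ha
  set b := d / (d + 1) with hb
  have hd : ∀ t, HasDerivAt (fun t => normMoment E 0 (-t) * Real.exp (t * a - b * t ^ 2 / 4))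
      (((a - b * t / 2) * normMoment E 0 (-t) - normMoment E 1 (-t)) *
        Real.exp (t * a - b * t ^ 2 / 4)) t := by
    intro t
    have h1 : HasDerivAt (fun t : ℝ => t * a - b * t ^ 2 / 4) (a - b * t / 2) t := by
      have := ((hasDerivAt_id t).mul_const a).sub
        ((((hasDerivAt_id t).pow 2).const_mul b).div_const 4)
      convert! this using 1; simp; ring
    have h2 := HasDerivAt.scomp t (hasDerivAt_normMoment_zero E (-t)) (hasDerivAt_neg t)
    convert! h2.mul h1.exp using 1
    simp
    ring
  have hanti : AntitoneOn (fun t => normMoment E 0 (-t) * Real.exp (t * a - b * t ^ 2 / 4))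
      (Set.Ici 0) := by
    refine antitoneOn_of_deriv_nonpos (convex_Ici 0)
      (fun x _ => (hd x).continuousAt.continuousWithinAt)
      (fun x _ => (hd x).differentiableAt.differentiableWithinAt) fun x hx => ?_
    rw [(hd x).deriv]
    simp only [interior_Ici, Set.mem_Ioi] at hx
    exact mul_nonpos_of_nonpos_of_nonneg (by linarith [hbd x hx.le]) (Real.exp_nonneg _)
  have h0s : (0 : ℝ) ≤ s := by linarith
  have := hanti (Set.mem_Ici.2 le_rfl) (Set.mem_Ici.2 h0s) h0s
  simp only [neg_zero, normMoment_zero_zero] at this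
  have h1 : normMoment E 0 (-s) ≤ Real.exp (-(s * a - b * s ^ 2 / 4)) := by
    rw [Real.exp_neg, ← one_div, le_div_iff₀ (by positivity)]
    simpa using this
  refine le_trans (by simp [normMoment]) (h1.trans (Real.exp_le_exp.2 ?_))
  have hb1 : b ≤ 1 := by rw [hb, div_le_one (by positivity)]; linarith
  have hd2 : √d ^ 2 = d := Real.sq_sqrt (by positivity)
  -- `√d - d / √(d + 1) ≤ √d / (d + 1) ≤ 1 / 4` as soon as `d ≥ 14`
  have h4 : √d - a ≤ 1 / 4 := by
    have hbs : b ≤ √b := by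
      have hb0 : 0 ≤ b := by positivity
      calc b = √b * √b := (Real.mul_self_sqrt hb0).symm
        _ ≤ √b * 1 := by gcongr; exact Real.sqrt_le_one.2 hb1
        _ = √b := mul_one _
    have hab : a = √d * √b := by
      rw [ha, hb, Real.sqrt_div (by positivity), ← mul_div_assoc, ← sq, hd2]
    have h374 : (374 / 100 : ℝ) ≤ √d := Real.le_sqrt_of_sq_le (by norm_num; linarith)
    have h5 : √d * (1 - b) ≤ 1 / 4 := by
      have : 1 - b = 1 / (d + 1) := by rw [hb]; field_simp; ring
      rw [this, mul_one_div, div_le_iff₀ (by positivity), ← hd2, Real.sqrt_sq (by positivity)]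
      nlinarith
    rw [hab]
    nlinarith [Real.sqrt_nonneg d]
  nlinarith [sq_nonneg s]

end NormMgf

/-! ### Gaussian interpolation -/

section Interpolation

/-- A function `F` with derivative `D` and second directional derivatives `H z d = D²F(z)(d, d)`,
all continuous and of at most exponential growth. -/
structure IsSmoothExpGrowth {W : Type*} [NormedAddCommGroup W] [NormedSpace ℝ W]
    (F : W → ℝ) (D : W → W →L[ℝ] ℝ) (H : W → W → ℝ) (C K : ℝ) : Prop where
  hasFDerivAt : ∀ z, HasFDerivAt F (D z) z
  hasDerivAt : ∀ z d, HasDerivAt (fun t : ℝ => D (z + t • d) d) (H z d) 0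
  continuous_fst : Continuous D
  continuous_snd : ∀ d, Continuous fun z => H z d
  nonneg : 0 ≤ K
  bound_zero : ∀ z, |F z| ≤ C * Real.exp (K * ‖z‖)
  bound_one : ∀ z d, |D z d| ≤ C * Real.exp (K * ‖z‖) * ‖d‖
  bound_two : ∀ z d, |H z d| ≤ C * Real.exp (K * ‖z‖) * ‖d‖ ^ 2

variable {W : Type*} [NormedAddCommGroup W] [NormedSpace ℝ W]
  {F : W → ℝ} {D : W → W →L[ℝ] ℝ} {H : W → W → ℝ} {C K : ℝ}

lemma IsSmoothExpGrowth.const_nonneg (hF : IsSmoothExpGrowth F D H C K) : 0 ≤ C := by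
  have := (abs_nonneg _).trans (hF.bound_zero 0)
  simpa using this

lemma IsSmoothExpGrowth.exp_le (hF : IsSmoothExpGrowth F D H C K) {z : W} {r : ℝ} (h : ‖z‖ ≤ r) :
    C * Real.exp (K * ‖z‖) ≤ C * Real.exp (K * r) := by
  have := hF.const_nonneg
  have := hF.nonneg
  gcongr

variable {E : Type*} [NormedAddCommGroup E] [InnerProductSpace ℝ E] [FiniteDimensional ℝ E]
  [MeasurableSpace E] [BorelSpace E]

omit [FiniteDimensional ℝ E] [MeasurableSpace E] [BorelSpace E] in
lemma norm_smul_apply_add_le (T : E →L[ℝ] W) (a : ℝ) (w : W) (x : E) :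
    ‖a • T x + w‖ ≤ |a| * ‖T‖ * ‖x‖ + ‖w‖ := by
  refine (norm_add_le _ _).trans ?_
  rw [norm_smul, Real.norm_eq_abs, mul_assoc]
  gcongr
  exact T.le_opNorm x

lemma IsSmoothExpGrowth.integrable_snd (hF : IsSmoothExpGrowth F D H C K) (T : E →L[ℝ] W)
    (a : ℝ) (w d : W) : Integrable (fun x => H (a • T x + w) d) (stdGaussian E) := by
  refine integrable_stdGaussian_of_le_exp (Continuous.aestronglyMeasurable ?_)
    (C * Real.exp (K * ‖w‖) * ‖d‖ ^ 2) (K * (|a| * ‖T‖)) fun x => ?_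
  · exact (hF.continuous_snd d).comp (by fun_prop)
  · refine (hF.bound_two _ d).trans ((mul_le_mul_of_nonneg_right
      (hF.exp_le (norm_smul_apply_add_le T a w x)) (by positivity)).trans_eq ?_)
    rw [mul_add, Real.exp_add]
    ring_nf

/-- Gaussian integration by parts along the image of a linear map. -/
lemma IsSmoothExpGrowth.integral_apply_self (hF : IsSmoothExpGrowth F D H C K)
    {ι : Type*} [Fintype ι] (b : OrthonormalBasis ι ℝ E) (T : E →L[ℝ] W) (a : ℝ) (w : W) :
    ∫ x, D (a • T x + w) (T x) ∂stdGaussian E =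
      a * ∫ x, ∑ i, H (a • T x + w) (T (b i)) ∂stdGaussian E := by
  have hDc : ∀ d, Continuous fun x : E => D (a • T x + w) d := fun d =>
    (hF.continuous_fst.comp (by fun_prop)).clm_apply continuous_const
  have hb1 : ∀ i (x : E), |D (a • T x + w) (T (b i))| ≤
      (C * Real.exp (K * ‖w‖) * ‖T (b i)‖) * Real.exp (K * (|a| * ‖T‖) * ‖x‖) := fun i x => by
    refine (hF.bound_one _ _).trans ((mul_le_mul_of_nonneg_right
      (hF.exp_le (norm_smul_apply_add_le T a w x)) (by positivity)).trans_eq ?_)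
    rw [mul_add, Real.exp_add]
    ring_nf
  have hi : ∀ i, Integrable (fun x => ⟪x, b i⟫ * D (a • T x + w) (T (b i))) (stdGaussian E) := by
    intro i
    refine integrable_stdGaussian_of_le_exp
      (((by fun_prop : Continuous fun x : E => ⟪x, b i⟫).mul (hDc _)).aestronglyMeasurable)
      (C * Real.exp (K * ‖w‖) * ‖T (b i)‖) (1 + K * (|a| * ‖T‖)) fun x => ?_
    rw [abs_mul, add_mul, one_mul, Real.exp_add, mul_left_comm]
    have h1 : |⟪x, b i⟫| ≤ Real.exp ‖x‖ := by
      have := abs_real_inner_le_norm x (b i)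
      rw [b.orthonormal.1 i, mul_one] at this
      linarith [Real.add_one_le_exp ‖x‖]
    exact mul_le_mul h1 (hb1 i x) (abs_nonneg _) (Real.exp_nonneg _)
  have hI : ∀ i, ∫ x, ⟪x, b i⟫ * D (a • T x + w) (T (b i)) ∂stdGaussian E =
      ∫ x, a * H (a • T x + w) (T (b i)) ∂stdGaussian E := by
    intro i
    refine integral_inner_mul_stdGaussian (b i) (fun x => ?_)
      (integrable_stdGaussian_of_le_exp (hDc _).aestronglyMeasurable _ _ (hb1 i))
      ((hF.integrable_snd T a w _).const_mul a) (hi i)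
    unfold HasLineDerivAt
    have h := hF.hasDerivAt (a • T x + w) (T (b i))
    have h2 : HasDerivAt (fun t : ℝ => a * t) a 0 := by
      simpa using (hasDerivAt_id (0 : ℝ)).const_mul a
    have h3 := HasDerivAt.scomp_of_eq (0 : ℝ) h h2 (by simp)
    convert! h3 using 1
    ext t
    simp only [Function.comp, map_add, map_smul]
    congr 2
    module
  have hx : ∀ (z : W) (x : E), D z (T x) = ∑ i, ⟪x, b i⟫ * D z (T (b i)) := by
    intro z x
    conv_lhs => rw [← b.sum_repr' x, map_sum T, map_sum]
    exact Finset.sum_congr rfl fun i _ => by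
      rw [map_smul T, map_smul, smul_eq_mul, real_inner_comm]
  rw [← integral_const_mul]
  simp only [Finset.mul_sum]
  rw [integral_congr_ae (Filter.Eventually.of_forall fun x => hx (a • T x + w) x)]
  rw [integral_finsetSum _ fun i _ => hi i,
    integral_finsetSum _ fun i _ => (hF.integrable_snd T a w _).const_mul a]
  exact Finset.sum_congr rfl fun i _ => hI i

variable {E' : Type*} [NormedAddCommGroup E'] [InnerProductSpace ℝ E'] [FiniteDimensional ℝ E']
  [MeasurableSpace E'] [BorelSpace E']

/-- **Gaussian interpolation.** If the Hessian of `F`, traced against the covariance of the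
Gaussian vector `T₀ x`, is everywhere at most its trace against the covariance of `T₁ y`, then
`𝔼 F(T₀ x) ≤ 𝔼 F(T₁ y)`. The proof differentiates along `cos θ • T₀ x + sin θ • T₁ y`. -/
theorem IsSmoothExpGrowth.integral_le_of_trace_le (hF : IsSmoothExpGrowth F D H C K)
    {ι κ : Type*} [Fintype ι] [Fintype κ] (b : OrthonormalBasis ι ℝ E)
    (b' : OrthonormalBasis κ ℝ E') (T₀ : E →L[ℝ] W) (T₁ : E' →L[ℝ] W)
    (htr : ∀ z, ∑ i, H z (T₀ (b i)) ≤ ∑ j, H z (T₁ (b' j))) :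
    ∫ x, F (T₀ x) ∂stdGaussian E ≤ ∫ y, F (T₁ y) ∂stdGaussian E' := by
  set μ := (stdGaussian E).prod (stdGaussian E') with hμ
  let r : E × E' → ℝ := fun p => ‖T₀‖ * ‖p.1‖ + ‖T₁‖ * ‖p.2‖
  let Z : ℝ → E × E' → W := fun θ p => Real.cos θ • T₀ p.1 + Real.sin θ • T₁ p.2
  let Z' : ℝ → E × E' → W := fun θ p => -Real.sin θ • T₀ p.1 + Real.cos θ • T₁ p.2
  have hcomb : ∀ (p : E × E') (c s : ℝ), |c| ≤ 1 → |s| ≤ 1 →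
      ‖c • T₀ p.1 + s • T₁ p.2‖ ≤ r p := by
    intro p c s hc hs
    refine (norm_add_le _ _).trans (add_le_add ?_ ?_)
    · rw [norm_smul]
      exact (mul_le_of_le_one_left (norm_nonneg _) hc).trans (T₀.le_opNorm _)
    · rw [norm_smul]
      exact (mul_le_of_le_one_left (norm_nonneg _) hs).trans (T₁.le_opNorm _)
  have hZ : ∀ θ p, ‖Z θ p‖ ≤ r p := fun θ p =>
    hcomb p _ _ (Real.abs_cos_le_one θ) (Real.abs_sin_le_one θ)
  have hZ' : ∀ θ p, ‖Z' θ p‖ ≤ r p := fun θ p =>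
    hcomb p _ _ (by rw [abs_neg]; exact Real.abs_sin_le_one θ) (Real.abs_cos_le_one θ)
  have hint : ∀ M : ℝ, Integrable (fun p => Real.exp (M * r p)) μ := by
    intro M
    have h1 := integrable_exp_mul_norm_stdGaussian (E := E) (M * ‖T₀‖)
    have h2 := integrable_exp_mul_norm_stdGaussian (E := E') (M * ‖T₁‖)
    refine (h1.mul_prod h2).congr (Filter.Eventually.of_forall fun p => ?_)
    simp only [r, ← Real.exp_add]
    ring_nf
  have hFc : Continuous F := continuous_iff_continuousAt.2 fun z => (hF.hasFDerivAt z).continuousAt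
  have hr0 : ∀ p, 0 ≤ r p := fun p => by positivity
  have hC := hF.const_nonneg
  have hD : ∀ θ p d, ‖d‖ ≤ r p → |D (Z θ p) d| ≤ C * Real.exp ((K + 1) * r p) := by
    intro θ p d hd
    refine (hF.bound_one _ _).trans ?_
    rw [add_mul, one_mul, Real.exp_add, ← mul_assoc]
    refine mul_le_mul (hF.exp_le (hZ θ p)) (hd.trans ?_) (norm_nonneg _) (by positivity)
    linarith [Real.add_one_le_exp (r p)]
  have hDi : ∀ θ (L : E × E' → W), Continuous L → (∀ p, ‖L p‖ ≤ r p) →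
      Integrable (fun p => D (Z θ p) (L p)) μ := by
    intro θ L hL hLr
    refine ((hint (K + 1)).const_mul C).mono' (Continuous.aestronglyMeasurable ?_)
      (Filter.Eventually.of_forall fun p => hD θ p _ (hLr p))
    exact (hF.continuous_fst.comp (by fun_prop)).clm_apply hL
  let φ : ℝ → ℝ := fun θ => ∫ p, F (Z θ p) ∂μ
  have hφ : ∀ θ, HasDerivAt φ (∫ p, D (Z θ p) (Z' θ p) ∂μ) θ := by
    intro θ
    refine (hasDerivAt_integral_of_dominated_loc_of_deriv_le (s := Set.univ) Filter.univ_mem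
      (bound := fun p => C * Real.exp ((K + 1) * r p)) (F' := fun θ p => D (Z θ p) (Z' θ p))
      (Filter.Eventually.of_forall fun θ => ?_) ?_ ?_ ?_ ((hint _).const_mul C) ?_).2
    · exact (hFc.comp (by fun_prop)).aestronglyMeasurable
    · refine ((hint K).const_mul C).mono' (hFc.comp (by fun_prop)).aestronglyMeasurable
        (Filter.Eventually.of_forall fun p => ?_)
      exact (hF.bound_zero _).trans (hF.exp_le (hZ θ p))
    · exact (hDi θ (Z' θ) (by fun_prop) (hZ' θ)).1
    · exact Filter.Eventually.of_forall fun p θ _ => hD θ p _ (hZ' θ p)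
    · refine Filter.Eventually.of_forall fun p θ _ => ?_
      have hz : HasDerivAt (fun θ => Z θ p) (Z' θ p) θ :=
        ((Real.hasDerivAt_cos θ).smul_const _).add ((Real.hasDerivAt_sin θ).smul_const _)
      exact (hF.hasFDerivAt (Z θ p)).comp_hasDerivAt θ hz
  have hH : ∀ θ (d : W), Integrable (fun p => H (Z θ p) d) μ := by
    intro θ d
    refine ((hint K).const_mul (C * ‖d‖ ^ 2)).mono'
      (((hF.continuous_snd d).comp (by fun_prop)).aestronglyMeasurable)
      (Filter.Eventually.of_forall fun p => ?_)
    refine (hF.bound_two _ _).trans ((mul_le_mul_of_nonneg_right (hF.exp_le (hZ θ p))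
      (by positivity)).trans_eq (by ring))
  have hderiv : ∀ θ, ∫ p, D (Z θ p) (Z' θ p) ∂μ =
      Real.sin θ * Real.cos θ * ∫ p, (∑ j, H (Z θ p) (T₁ (b' j)) - ∑ i, H (Z θ p) (T₀ (b i))) ∂μ := by
    intro θ
    have i0 := hDi θ (fun p => T₀ p.1) (by fun_prop) fun p => by
      simpa using hcomb p 1 0 (by simp) (by simp)
    have i1 := hDi θ (fun p => T₁ p.2) (by fun_prop) fun p => by
      simpa using hcomb p 0 1 (by simp) (by simp)
    have e0 : ∫ p, D (Z θ p) (T₀ p.1) ∂μ =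
        Real.cos θ * ∫ p, ∑ i, H (Z θ p) (T₀ (b i)) ∂μ := by
      rw [hμ, integral_prod_symm _ i0, integral_prod_symm _ (integrable_finsetSum _ fun i _ => hH θ _),
        ← integral_const_mul]
      congr 1; ext y
      exact hF.integral_apply_self b T₀ (Real.cos θ) (Real.sin θ • T₁ y)
    have e1 : ∫ p, D (Z θ p) (T₁ p.2) ∂μ =
        Real.sin θ * ∫ p, ∑ j, H (Z θ p) (T₁ (b' j)) ∂μ := by
      rw [hμ, integral_prod _ i1, integral_prod _ (integrable_finsetSum _ fun i _ => hH θ _),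
        ← integral_const_mul]
      congr 1; ext x
      simp only [Z, add_comm (Real.cos θ • T₀ x)]
      exact hF.integral_apply_self b' T₁ (Real.sin θ) (Real.cos θ • T₀ x)
    have e2 : ∀ p, D (Z θ p) (Z' θ p) =
        -Real.sin θ * D (Z θ p) (T₀ p.1) + Real.cos θ * D (Z θ p) (T₁ p.2) := fun p => by
      simp only [Z', map_add, map_smul, smul_eq_mul]
    simp_rw [e2]
    rw [integral_add (i0.const_mul _) (i1.const_mul _), integral_const_mul, integral_const_mul, e0,
      e1, integral_sub (integrable_finsetSum _ fun i _ => hH θ _)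
        (integrable_finsetSum _ fun i _ => hH θ _)]
    ring
  have hmono : MonotoneOn φ (Set.Icc 0 (Real.pi / 2)) := by
    refine monotoneOn_of_deriv_nonneg (convex_Icc _ _)
      (fun θ _ => (hφ θ).continuousAt.continuousWithinAt)
      (fun θ _ => (hφ θ).differentiableAt.differentiableWithinAt) fun θ hθ => ?_
    rw [interior_Icc] at hθ
    rw [(hφ θ).deriv, hderiv]
    refine mul_nonneg (mul_nonneg ?_ ?_) (integral_nonneg fun p => sub_nonneg.2 (htr _))
    · exact Real.sin_nonneg_of_nonneg_of_le_pi hθ.1.le (by linarith [hθ.2, Real.pi_pos])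
    · exact Real.cos_nonneg_of_neg_pi_div_two_le_of_le (by linarith [hθ.1, Real.pi_pos]) hθ.2.le
  have h0 : φ 0 = ∫ x, F (T₀ x) ∂stdGaussian E := by
    simp only [φ, Z, Real.cos_zero, Real.sin_zero, one_smul, zero_smul, add_zero, hμ]
    rw [integral_fun_fst (fun x => F (T₀ x))]
    simp
  have h1 : φ (Real.pi / 2) = ∫ y, F (T₁ y) ∂stdGaussian E' := by
    simp only [φ, Z, Real.cos_pi_div_two, Real.sin_pi_div_two, one_smul, zero_smul, zero_add, hμ]
    rw [integral_fun_snd (fun x => F (T₁ x))]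
    simp
  rw [← h0, ← h1]
  have hp : 0 ≤ Real.pi / 2 := by positivity
  exact hmono (Set.left_mem_Icc.2 hp) (Set.right_mem_Icc.2 hp) hp

end Interpolation

/-! ### The smoothed norm -/

section SmoothedNorm

variable {V : Type*} [NormedAddCommGroup V] [InnerProductSpace ℝ V]

/-- The smooth approximation `√(δ² + ‖z‖²)` of the norm. -/
noncomputable def smoothNorm (δ : ℝ) (z : V) : ℝ := √(δ ^ 2 + ‖z‖ ^ 2)

omit [InnerProductSpace ℝ V] in
lemma smoothNorm_sq (δ : ℝ) (z : V) : smoothNorm δ z ^ 2 = δ ^ 2 + ‖z‖ ^ 2 :=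
  Real.sq_sqrt (by positivity)

omit [InnerProductSpace ℝ V] in
lemma norm_le_smoothNorm (δ : ℝ) (z : V) : ‖z‖ ≤ smoothNorm δ z :=
  Real.le_sqrt_of_sq_le (by nlinarith [sq_nonneg δ])

omit [InnerProductSpace ℝ V] in
lemma smoothNorm_le {δ : ℝ} (hδ : 0 < δ) (z : V) : smoothNorm δ z ≤ ‖z‖ + δ :=
  Real.sqrt_le_iff.2 ⟨by positivity, by nlinarith [norm_nonneg z]⟩

omit [InnerProductSpace ℝ V] in
lemma le_smoothNorm (δ : ℝ) (z : V) : δ ≤ smoothNorm δ z :=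
  Real.le_sqrt_of_sq_le (by nlinarith [sq_nonneg ‖z‖])

omit [InnerProductSpace ℝ V] in
lemma smoothNorm_pos {δ : ℝ} (hδ : 0 < δ) (z : V) : 0 < smoothNorm δ z :=
  hδ.trans_le (le_smoothNorm δ z)

omit [InnerProductSpace ℝ V] in
@[fun_prop]
lemma continuous_smoothNorm (δ : ℝ) : Continuous (smoothNorm δ : V → ℝ) := by
  unfold smoothNorm; fun_prop

/-- The functional `(z, s) ↦ √(δ² + ‖z‖²) + s` on `V × ℝ`. -/
noncomputable def shiftedNorm (δ : ℝ) (p : V × ℝ) : ℝ := smoothNorm δ p.1 + p.2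

/-- The derivative of `shiftedNorm`. -/
noncomputable def shiftedNormDeriv (δ : ℝ) (p : V × ℝ) : V × ℝ →L[ℝ] ℝ :=
  (smoothNorm δ p.1)⁻¹ • (innerSL ℝ p.1).comp (ContinuousLinearMap.fst ℝ V ℝ) +
    ContinuousLinearMap.snd ℝ V ℝ

/-- The Hessian quadratic form of `shiftedNorm`. -/
noncomputable def shiftedNormHess (δ : ℝ) (p d : V × ℝ) : ℝ :=
  (‖d.1‖ ^ 2 - (⟪p.1, d.1⟫ / smoothNorm δ p.1) ^ 2) / smoothNorm δ p.1

lemma shiftedNormDeriv_apply (δ : ℝ) (p d : V × ℝ) :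
    shiftedNormDeriv δ p d = ⟪p.1, d.1⟫ / smoothNorm δ p.1 + d.2 := by
  simp [shiftedNormDeriv, div_eq_inv_mul]

variable {δ : ℝ}

lemma hasFDerivAt_shiftedNorm (hδ : 0 < δ) (p : V × ℝ) :
    HasFDerivAt (shiftedNorm δ) (shiftedNormDeriv δ p) p := by
  have h1 : HasFDerivAt (fun q : V × ℝ => q.1) (ContinuousLinearMap.fst ℝ V ℝ) p := hasFDerivAt_fst
  have h2 := ((h1.norm_sq).const_add (δ ^ 2)).sqrt
    (by rw [← smoothNorm_sq]; exact (pow_pos (smoothNorm_pos hδ _) 2).ne')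
  have h3 := h2.add (hasFDerivAt_snd (𝕜 := ℝ) (p := p))
  convert! h3 using 1
  ext
  · simp [shiftedNormDeriv, smoothNorm]
    ring
  · simp [shiftedNormDeriv]

omit [InnerProductSpace ℝ V] in
lemma continuous_shiftedNorm : Continuous (shiftedNorm δ : V × ℝ → ℝ) := by
  unfold shiftedNorm; fun_prop

lemma continuous_shiftedNormDeriv (hδ : 0 < δ) :
    Continuous (shiftedNormDeriv δ : V × ℝ → V × ℝ →L[ℝ] ℝ) := by
  unfold shiftedNormDeriv
  have : Continuous fun p : V × ℝ => (smoothNorm δ p.1)⁻¹ :=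
    Continuous.inv₀ (by fun_prop) fun p => (smoothNorm_pos hδ _).ne'
  have h2 : Continuous fun p : V × ℝ => (innerSL ℝ p.1).comp (ContinuousLinearMap.fst ℝ V ℝ) :=
    ((innerSL ℝ).continuous.comp continuous_fst).clm_comp continuous_const
  exact (this.smul h2).add continuous_const

lemma continuous_shiftedNormHess (hδ : 0 < δ) (d : V × ℝ) :
    Continuous fun p => shiftedNormHess δ p d := by
  unfold shiftedNormHess
  have h : Continuous fun p : V × ℝ => smoothNorm δ p.1 := by fun_prop
  have h0 : ∀ p : V × ℝ, smoothNorm δ p.1 ≠ 0 := fun p => (smoothNorm_pos hδ _).ne'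
  exact (continuous_const.sub (((by fun_prop : Continuous fun p : V × ℝ => ⟪p.1, d.1⟫).div h
    h0).pow 2)).div h h0

lemma hasDerivAt_shiftedNormDeriv (hδ : 0 < δ) (p d : V × ℝ) :
    HasDerivAt (fun t : ℝ => shiftedNormDeriv δ (p + t • d) d) (shiftedNormHess δ p d) 0 := by
  have hρ := smoothNorm_pos hδ p.1
  have hl : HasDerivAt (fun t : ℝ => p.1 + t • d.1) d.1 0 := by
    simpa using ((hasDerivAt_id (0 : ℝ)).smul_const d.1).const_add p.1
  have h2 : HasDerivAt (fun t : ℝ => smoothNorm δ (p.1 + t • d.1)) (⟪p.1, d.1⟫ / smoothNorm δ p.1)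
      0 := by
    have := ((hl.norm_sq).const_add (δ ^ 2)).sqrt
      (by rw [← smoothNorm_sq]; exact (pow_pos (smoothNorm_pos hδ _) 2).ne')
    rw [zero_smul, add_zero, mul_div_mul_left _ _ two_ne_zero] at this
    exact this
  have h1 : HasDerivAt (fun t : ℝ => ⟪p.1 + t • d.1, d.1⟫) (‖d.1‖ ^ 2) 0 := by
    have := hl.inner ℝ (hasDerivAt_const (0 : ℝ) d.1)
    simpa using this
  have h3 := (h1.div h2 (by simpa using hρ.ne')).add_const d.2
  convert! h3 using 1
  · ext t
    simp [shiftedNormDeriv_apply]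
  · simp only [zero_smul, add_zero, shiftedNormHess]
    field_simp

lemma abs_inner_div_smoothNorm_le (hδ : 0 < δ) (z d : V) : |⟪z, d⟫ / smoothNorm δ z| ≤ ‖d‖ := by
  rw [abs_div, abs_of_pos (smoothNorm_pos hδ z), div_le_iff₀ (smoothNorm_pos hδ z), mul_comm]
  exact (abs_real_inner_le_norm z d).trans (by gcongr; exact norm_le_smoothNorm δ z)

lemma abs_shiftedNormDeriv_le (hδ : 0 < δ) (p d : V × ℝ) :
    |shiftedNormDeriv δ p d| ≤ 2 * ‖d‖ := by
  rw [shiftedNormDeriv_apply, two_mul]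
  exact (abs_add_le _ _).trans (add_le_add
    ((abs_inner_div_smoothNorm_le hδ _ _).trans (norm_fst_le d)) (norm_snd_le d))

lemma abs_shiftedNormHess_le (hδ : 0 < δ) (p d : V × ℝ) :
    |shiftedNormHess δ p d| ≤ ‖d‖ ^ 2 / δ := by
  have h1 : (⟪p.1, d.1⟫ / smoothNorm δ p.1) ^ 2 ≤ ‖d.1‖ ^ 2 := by
    rw [← sq_abs]
    exact pow_le_pow_left₀ (abs_nonneg _) (abs_inner_div_smoothNorm_le hδ _ _) 2
  have h2 : ‖d.1‖ ^ 2 ≤ ‖d‖ ^ 2 := by gcongr; exact norm_fst_le d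
  rw [shiftedNormHess, abs_div, abs_of_pos (smoothNorm_pos hδ _), abs_of_nonneg (by linarith)]
  have := sq_nonneg (⟪p.1, d.1⟫ / smoothNorm δ p.1)
  gcongr
  · linarith
  · exact le_smoothNorm δ p.1

omit [InnerProductSpace ℝ V] in
lemma abs_shiftedNorm_le (hδ : 0 < δ) (p : V × ℝ) : |shiftedNorm δ p| ≤ δ + 2 * ‖p‖ := by
  refine (abs_add_le _ _).trans ?_
  have h1 := smoothNorm_le hδ p.1
  have h2 : |p.2| ≤ ‖p‖ := norm_snd_le p
  have h3 := norm_fst_le p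
  rw [abs_of_pos (smoothNorm_pos hδ p.1)]
  linarith

end SmoothedNorm

/-! ### The smoothed minimax functional -/

section GordonFunctional

variable {V : Type*} [NormedAddCommGroup V] [InnerProductSpace ℝ V] {U : Type*} [Fintype U]

/-- The partition function `∑ u, exp (c * (√(δ² + ‖z u‖²) + s u))`. -/
noncomputable def partitionSum (c δ : ℝ) (z : U → V × ℝ) : ℝ :=
  ∑ u, Real.exp (c * shiftedNorm δ (z u))

/-- The functional `(∑ u, exp (c * (√(δ² + ‖z u‖²) + s u))) ^ η`, a smooth substitute for
`exp (c * η * ext_u (‖z u‖ + s u))`, the extremum being a maximum for `c > 0` and a minimum for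
`c < 0`. -/
noncomputable def gordonFun (c η δ : ℝ) (z : U → V × ℝ) : ℝ := partitionSum c δ z ^ η

/-- The derivative of `gordonFun`. -/
noncomputable def gordonDeriv (c η δ : ℝ) (z : U → V × ℝ) : (U → V × ℝ) →L[ℝ] ℝ :=
  (η * c * partitionSum c δ z ^ (η - 1)) • ∑ u, Real.exp (c * shiftedNorm δ (z u)) •
    (shiftedNormDeriv δ (z u)).comp (ContinuousLinearMap.proj u)

/-- The Hessian quadratic form of `gordonFun`. -/
noncomputable def gordonHess (c η δ : ℝ) (z d : U → V × ℝ) : ℝ :=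
  η * c * ((η - 1) * c * partitionSum c δ z ^ (η - 2) *
      (∑ u, Real.exp (c * shiftedNorm δ (z u)) * shiftedNormDeriv δ (z u) (d u)) ^ 2 +
    partitionSum c δ z ^ (η - 1) * ∑ u, Real.exp (c * shiftedNorm δ (z u)) *
      (c * shiftedNormDeriv δ (z u) (d u) ^ 2 + shiftedNormHess δ (z u) (d u)))

lemma gordonDeriv_apply (c η δ : ℝ) (z d : U → V × ℝ) :
    gordonDeriv c η δ z d = η * c * partitionSum c δ z ^ (η - 1) *
      ∑ u, Real.exp (c * shiftedNorm δ (z u)) * shiftedNormDeriv δ (z u) (d u) := by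
  simp [gordonDeriv]

omit [InnerProductSpace ℝ V] in
lemma partitionSum_pos [Nonempty U] (c δ : ℝ) (z : U → V × ℝ) : 0 < partitionSum c δ z :=
  Finset.sum_pos (fun _ _ => Real.exp_pos _) Finset.univ_nonempty

omit [InnerProductSpace ℝ V] in
@[fun_prop]
lemma continuous_partitionSum (c δ : ℝ) : Continuous (partitionSum c δ : (U → V × ℝ) → ℝ) := by
  unfold partitionSum
  have := continuous_shiftedNorm (V := V) (δ := δ)
  fun_prop

omit [InnerProductSpace ℝ V] in
lemma continuous_partitionSum_rpow [Nonempty U] (c δ r : ℝ) :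
    Continuous fun z : U → V × ℝ => partitionSum c δ z ^ r :=
  (continuous_partitionSum c δ).rpow_const fun z => Or.inl (partitionSum_pos c δ z).ne'

lemma hasFDerivAt_partitionSum {δ : ℝ} (hδ : 0 < δ) (c : ℝ) (z : U → V × ℝ) :
    HasFDerivAt (partitionSum c δ) (c • ∑ u, Real.exp (c * shiftedNorm δ (z u)) •
      (shiftedNormDeriv δ (z u)).comp (ContinuousLinearMap.proj (R := ℝ)
        (φ := fun _ : U => V × ℝ) u)) z := by
  have h : ∀ u ∈ (Finset.univ : Finset U), HasFDerivAt
      (fun z : U → V × ℝ => Real.exp (c * shiftedNorm δ (z u)))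
      (Real.exp (c * shiftedNorm δ (z u)) • (c • (shiftedNormDeriv δ (z u)).comp
        (ContinuousLinearMap.proj (R := ℝ) (φ := fun _ : U => V × ℝ) u))) z := fun u _ =>
    ((HasFDerivAt.comp (g := shiftedNorm δ) (f := fun z : U → V × ℝ => z u) z
      (hasFDerivAt_shiftedNorm hδ (z u)) (hasFDerivAt_apply u z)).const_mul c).exp
  convert! HasFDerivAt.fun_sum h using 1
  rw [Finset.smul_sum]
  exact Finset.sum_congr rfl fun u _ => smul_comm _ _ _

omit [InnerProductSpace ℝ V] in
lemma abs_sum_exp_mul_le {c δ B : ℝ} (z : U → V × ℝ) (f : U → ℝ) (hf : ∀ u, |f u| ≤ B) :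
    |∑ u, Real.exp (c * shiftedNorm δ (z u)) * f u| ≤ partitionSum c δ z * B := by
  refine (Finset.abs_sum_le_sum_abs _ _).trans ?_
  rw [partitionSum, Finset.sum_mul]
  refine Finset.sum_le_sum fun u _ => ?_
  rw [abs_mul, abs_of_pos (Real.exp_pos _)]
  exact mul_le_mul_of_nonneg_left (hf u) (Real.exp_nonneg _)

omit [InnerProductSpace ℝ V] in
lemma partitionSum_rpow_le [Nonempty U] {c η δ : ℝ} (hη : 0 ≤ η) (hδ : 0 < δ) (z : U → V × ℝ) :
    partitionSum c δ z ^ η ≤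
      (Fintype.card U) ^ η * Real.exp (η * |c| * δ) * Real.exp (2 * η * |c| * ‖z‖) := by
  have h : partitionSum c δ z ≤ Fintype.card U * Real.exp (|c| * (δ + 2 * ‖z‖)) := by
    rw [partitionSum]
    refine (Finset.sum_le_card_nsmul _ _ (Real.exp (|c| * (δ + 2 * ‖z‖))) fun u _ => ?_).trans_eq
      (by simp)
    rw [Real.exp_le_exp]
    refine (le_abs_self _).trans ?_
    rw [abs_mul]
    gcongr
    exact (abs_shiftedNorm_le hδ _).trans (by gcongr; exact norm_le_pi_norm z u)
  refine (Real.rpow_le_rpow (partitionSum_pos c δ z).le h hη).trans_eq ?_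
  rw [Real.mul_rpow (by positivity) (Real.exp_nonneg _), ← Real.exp_mul,
    mul_assoc ((Fintype.card U : ℝ) ^ η), ← Real.exp_add]
  congr 2
  ring

/-- The functional `gordonFun` is smooth and of at most exponential growth. -/
lemma isSmoothExpGrowth_gordonFun [Nonempty U] {c η δ : ℝ} (hη : 0 ≤ η) (hδ : 0 < δ) :
    IsSmoothExpGrowth (gordonFun c η δ : (U → V × ℝ) → ℝ) (gordonDeriv c η δ) (gordonHess c η δ)
      (((Fintype.card U) ^ η * Real.exp (η * |c| * δ)) *
        (1 + η * |c| * 2 + η * |c| * (|η - 1| * |c| * 4 + (4 * |c| + 1 / δ))))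
      (2 * η * |c|) := by
  have hpow : ∀ (z : U → V × ℝ) (r s : ℝ),
      partitionSum c δ z ^ r * partitionSum c δ z ^ s = partitionSum c δ z ^ (r + s) :=
    fun z r s => (Real.rpow_add (partitionSum_pos c δ z) r s).symm
  have hG1 : ∀ z : U → V × ℝ, partitionSum c δ z ^ (η - 1) * partitionSum c δ z
      = partitionSum c δ z ^ η := fun z => by
    conv_lhs => rw [← Real.rpow_one (partitionSum c δ z), ← Real.rpow_mul
      (partitionSum_pos c δ z).le, one_mul]
    rw [hpow]; ring_nf
  have hG2 : ∀ z : U → V × ℝ, partitionSum c δ z ^ (η - 2) * partitionSum c δ z ^ 2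
      = partitionSum c δ z ^ η := fun z => by
    rw [← Real.rpow_natCast (partitionSum c δ z) 2, hpow]; norm_num
  have hdn : ∀ (d : U → V × ℝ) u, ‖d u‖ ≤ ‖d‖ := fun d u => norm_le_pi_norm d u
  have hd1 : ∀ (z d : U → V × ℝ),
      |∑ u, Real.exp (c * shiftedNorm δ (z u)) * shiftedNormDeriv δ (z u) (d u)| ≤
        partitionSum c δ z * (2 * ‖d‖) := fun z d =>
    abs_sum_exp_mul_le z _ fun u =>
      (abs_shiftedNormDeriv_le hδ _ _).trans (by gcongr; exact hdn d u)
  set Q := (Fintype.card U : ℝ) ^ η * Real.exp (η * |c| * δ) with hQ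
  have hQ0 : 0 ≤ Q := by positivity
  set A := η * |c| * 2 with hA
  set B := η * |c| * (|η - 1| * |c| * 4 + (4 * |c| + 1 / δ)) with hB
  have hA0 : 0 ≤ A := by positivity
  have hB0 : 0 ≤ B := by positivity
  have hle : ∀ (z : U → V × ℝ) (M : ℝ), 0 ≤ M → M ≤ 1 + A + B →
      partitionSum c δ z ^ η * M ≤ Q * (1 + A + B) * Real.exp (2 * η * |c| * ‖z‖) := by
    intro z M h0 hM
    calc partitionSum c δ z ^ η * M ≤ (Q * Real.exp (2 * η * |c| * ‖z‖)) * (1 + A + B) :=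
          mul_le_mul (partitionSum_rpow_le hη hδ z) hM h0 (by positivity)
      _ = _ := by ring
  refine ⟨fun z => ?_, fun z d => ?_, ?_, fun d => ?_, by positivity, fun z => ?_, fun z d => ?_,
    fun z d => ?_⟩
  · have := (hasFDerivAt_partitionSum hδ c z).rpow_const (p := η)
      (Or.inl (partitionSum_pos c δ z).ne')
    convert! this using 1
    rw [gordonDeriv, smul_smul]
    congr 1
    ring
  · simp only [gordonDeriv_apply]
    have hl : ∀ u, HasDerivAt (fun t : ℝ => (z + t • d) u) (d u) 0 := fun u => by
      simpa using ((hasDerivAt_id (0 : ℝ)).smul_const (d u)).const_add (z u)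
    have he : ∀ u, HasDerivAt (fun t : ℝ => Real.exp (c * shiftedNorm δ ((z + t • d) u)))
        (Real.exp (c * shiftedNorm δ (z u)) * (c * shiftedNormDeriv δ (z u) (d u))) 0 := by
      intro u
      have h1 := HasFDerivAt.comp_hasDerivAt_of_eq (0 : ℝ) (hasFDerivAt_shiftedNorm hδ (z u))
        (hl u) (by simp)
      have := (h1.const_mul c).exp
      simpa using this
    have hs : HasDerivAt (fun t : ℝ => partitionSum c δ (z + t • d))
        (∑ u, Real.exp (c * shiftedNorm δ (z u)) * (c * shiftedNormDeriv δ (z u) (d u))) 0 :=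
      HasDerivAt.fun_sum fun u _ => he u
    have hr := (hs.rpow_const (p := η - 1)
      (Or.inl (partitionSum_pos c δ _).ne')).const_mul (η * c)
    have ht : HasDerivAt (fun t : ℝ => ∑ u, Real.exp (c * shiftedNorm δ ((z + t • d) u)) *
        shiftedNormDeriv δ ((z + t • d) u) (d u))
        (∑ u, (Real.exp (c * shiftedNorm δ (z u)) * (c * shiftedNormDeriv δ (z u) (d u)) *
          shiftedNormDeriv δ (z u) (d u) + Real.exp (c * shiftedNorm δ (z u)) *
            shiftedNormHess δ (z u) (d u))) 0 := by
      refine HasDerivAt.fun_sum fun u _ => ?_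
      convert! (he u).mul (hasDerivAt_shiftedNormDeriv hδ (z u) (d u)) using 1
      simp
    convert! hr.mul ht using 1
    simp only [zero_smul, add_zero]
    rw [gordonHess, show η - 1 - 1 = η - 2 by ring]
    have e1 : ∑ u, Real.exp (c * shiftedNorm δ (z u)) * (c * shiftedNormDeriv δ (z u) (d u)) =
        c * ∑ u, Real.exp (c * shiftedNorm δ (z u)) * shiftedNormDeriv δ (z u) (d u) := by
      rw [Finset.mul_sum]; exact Finset.sum_congr rfl fun u _ => by ring
    have e2 : ∑ u, (Real.exp (c * shiftedNorm δ (z u)) * (c * shiftedNormDeriv δ (z u) (d u)) *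
          shiftedNormDeriv δ (z u) (d u) + Real.exp (c * shiftedNorm δ (z u)) *
            shiftedNormHess δ (z u) (d u)) = ∑ u, Real.exp (c * shiftedNorm δ (z u)) *
      (c * shiftedNormDeriv δ (z u) (d u) ^ 2 + shiftedNormHess δ (z u) (d u)) :=
      Finset.sum_congr rfl fun u _ => by ring
    rw [e1, e2]
    ring
  · unfold gordonDeriv
    have h1 := continuous_partitionSum_rpow (U := U) (V := V) c δ (η - 1)
    have h2 := continuous_shiftedNorm (V := V) (δ := δ)
    have h3 := continuous_shiftedNormDeriv (V := V) hδ
    refine (continuous_const.mul h1).smul (continuous_finsetSum _ fun u _ => ?_)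
    exact (by fun_prop : Continuous fun z : U → V × ℝ => Real.exp (c * shiftedNorm δ (z u))).smul
      ((h3.comp (continuous_apply u)).clm_comp continuous_const)
  · unfold gordonHess
    have h0 := continuous_partitionSum_rpow (U := U) (V := V) c δ (η - 2)
    have h1 := continuous_partitionSum_rpow (U := U) (V := V) c δ (η - 1)
    have h2 := continuous_shiftedNorm (V := V) (δ := δ)
    have h3 : ∀ u, Continuous fun z : U → V × ℝ => shiftedNormDeriv δ (z u) (d u) := fun u =>
      ((continuous_shiftedNormDeriv (V := V) hδ).comp (continuous_apply u)).clm_apply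
        continuous_const
    have h4 : ∀ u, Continuous fun z : U → V × ℝ => shiftedNormHess δ (z u) (d u) := fun u =>
      (continuous_shiftedNormHess (V := V) hδ (d u)).comp (continuous_apply u)
    fun_prop
  · rw [gordonFun, abs_of_nonneg (Real.rpow_nonneg (partitionSum_pos c δ z).le _)]
    simpa using hle z 1 zero_le_one (by linarith)
  · rw [gordonDeriv_apply, abs_mul, abs_mul, abs_mul, abs_of_nonneg hη,
      abs_of_nonneg (Real.rpow_nonneg (partitionSum_pos c δ z).le _)]
    calc _ ≤ η * |c| * partitionSum c δ z ^ (η - 1) * (partitionSum c δ z * (2 * ‖d‖)) := by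
          have := Real.rpow_nonneg (partitionSum_pos c δ z).le (η - 1)
          gcongr
          exact hd1 z d
      _ = partitionSum c δ z ^ η * A * ‖d‖ := by rw [← hG1 z]; ring
      _ ≤ _ := mul_le_mul_of_nonneg_right (hle z A hA0 (by linarith)) (norm_nonneg _)
  · have p1 := Real.rpow_nonneg (partitionSum_pos c δ z).le (η - 1)
    have p2 := Real.rpow_nonneg (partitionSum_pos c δ z).le (η - 2)
    have hs : |∑ u, Real.exp (c * shiftedNorm δ (z u)) *
        (c * shiftedNormDeriv δ (z u) (d u) ^ 2 + shiftedNormHess δ (z u) (d u))| ≤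
        partitionSum c δ z * ((4 * |c| + 1 / δ) * ‖d‖ ^ 2) := by
      refine abs_sum_exp_mul_le z _ fun u => (abs_add_le _ _).trans ?_
      rw [add_mul]
      refine add_le_add ?_ ?_
      · rw [abs_mul, abs_pow, mul_comm (4 : ℝ), mul_assoc]
        gcongr
        calc |shiftedNormDeriv δ (z u) (d u)| ^ 2 ≤ (2 * ‖d‖) ^ 2 := by
              gcongr
              exact (abs_shiftedNormDeriv_le hδ _ _).trans (by gcongr; exact hdn d u)
          _ = 4 * ‖d‖ ^ 2 := by ring
      · refine (abs_shiftedNormHess_le hδ _ _).trans ?_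
        rw [one_div, inv_mul_eq_div]
        gcongr
        exact hdn d u
    have hsq : |∑ u, Real.exp (c * shiftedNorm δ (z u)) * shiftedNormDeriv δ (z u) (d u)| ^ 2 ≤
        (partitionSum c δ z * (2 * ‖d‖)) ^ 2 := pow_le_pow_left₀ (abs_nonneg _) (hd1 z d) 2
    rw [gordonHess, abs_mul, abs_mul, abs_of_nonneg hη]
    calc _ ≤ η * |c| * (|η - 1| * |c| * partitionSum c δ z ^ (η - 2) *
            (partitionSum c δ z * (2 * ‖d‖)) ^ 2 + partitionSum c δ z ^ (η - 1) *
              (partitionSum c δ z * ((4 * |c| + 1 / δ) * ‖d‖ ^ 2))) := by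
          gcongr
          refine (abs_add_le _ _).trans (add_le_add ?_ ?_)
          · rw [abs_mul, abs_mul, abs_mul, abs_of_nonneg p2, abs_pow]
            gcongr
          · rw [abs_mul, abs_of_nonneg p1]
            gcongr
      _ = η * |c| * (|η - 1| * |c| * 4 *
            (partitionSum c δ z ^ (η - 2) * partitionSum c δ z ^ 2) +
            (partitionSum c δ z ^ (η - 1) * partitionSum c δ z) * (4 * |c| + 1 / δ)) * ‖d‖ ^ 2 := by
          ring
      _ = partitionSum c δ z ^ η * B * ‖d‖ ^ 2 := by rw [hG1, hG2]; ring
      _ ≤ _ := mul_le_mul_of_nonneg_right (hle z B hB0 (by linarith)) (by positivity)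

end GordonFunctional

/-! ### Standard Gaussian measures on products -/

section ProductGaussian

lemma stdGaussian_prod (E F : Type*) [NormedAddCommGroup E] [InnerProductSpace ℝ E]
    [FiniteDimensional ℝ E] [MeasurableSpace E] [BorelSpace E] [NormedAddCommGroup F]
    [InnerProductSpace ℝ F] [FiniteDimensional ℝ F] [MeasurableSpace F] [BorelSpace F] :
    stdGaussian (WithLp 2 (E × F)) =
      ((stdGaussian E).prod (stdGaussian F)).map (WithLp.toLp 2) := by
  have : IsProbabilityMeasure
      (((stdGaussian E).prod (stdGaussian F)).map (WithLp.toLp 2 : E × F → WithLp 2 (E × F))) :=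
    Measure.isProbabilityMeasure_map (Measurable.aemeasurable (by fun_prop))
  refine Measure.ext_of_charFun ?_
  ext t
  rw [charFun_eq_prod_iff.2 rfl t, charFun_stdGaussian, charFun_stdGaussian, charFun_stdGaussian,
    ← Complex.exp_add, ← Complex.ofReal_pow, WithLp.prod_norm_sq_eq_of_L2]
  congr 1
  push_cast
  simp only [WithLp.fst, WithLp.snd]
  ring

lemma integral_exp_mul_stdGaussian_real (t : ℝ) :
    ∫ s, Real.exp (t * s) ∂stdGaussian ℝ = Real.exp (t ^ 2 / 2) := by
  have h : stdGaussian ℝ = gaussianReal 0 1 := by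
    refine Measure.ext_of_charFun ?_
    ext t
    rw [charFun_stdGaussian, charFun_gaussianReal]
    congr 1
    simp [← Complex.ofReal_pow, neg_div]
  rw [h]
  have := mgf_gaussianReal (p := gaussianReal 0 1) (X := id) (μ := 0) (v := 1) (by simp) t
  simpa [mgf] using this

end ProductGaussian

/-! ### Gordon comparison for Gaussian frame maps -/

section Comparison

variable {V : Type*} [NormedAddCommGroup V] [InnerProductSpace ℝ V]
  {U ι κ : Type*} [Fintype U] [Fintype ι] [Fintype κ]

/-- `q` is a Parseval frame of `V`, expressed by the polarized form of
`∑ i, ⟪w, q i⟫ ^ 2 = ‖w‖ ^ 2`. -/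
def IsParsevalFrame (q : ι → V) : Prop :=
  ∀ w w' : V, ∑ i, ⟪w, q i⟫ * ⟪w', q i⟫ = ⟪w, w'⟫

lemma IsParsevalFrame.sum_norm_sq [FiniteDimensional ℝ V] {q : ι → V} (hq : IsParsevalFrame q) :
    ∑ i, ‖q i‖ ^ 2 = Module.finrank ℝ V := by
  have hq' : ∀ w w' : V, ∑ i, ⟪w, q i⟫ * ⟪w', q i⟫ = ⟪w, w'⟫ := hq
  have b := stdOrthonormalBasis ℝ V
  have h : ∀ i, ‖q i‖ ^ 2 = ∑ k, ⟪b k, q i⟫ * ⟪b k, q i⟫ := fun i => by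
    rw [← b.sum_sq_inner_right (q i)]
    exact Finset.sum_congr rfl fun k _ => sq _
  simp_rw [h]
  rw [Finset.sum_comm]
  simp_rw [hq', real_inner_self_eq_norm_sq, b.orthonormal.1]
  simp

/-- The vector `∑ i, (∑ j, x (i, j) * u j) • q i`, linear in the matrix `x`: the image of `x u`
under the synthesis map of the family `q`. -/
noncomputable def frameMap (q : ι → V) (u : EuclideanSpace ℝ κ) :
    EuclideanSpace ℝ (ι × κ) →L[ℝ] V :=
  ∑ i, ∑ j, (u j • (EuclideanSpace.proj (i, j) : EuclideanSpace ℝ (ι × κ) →L[ℝ] ℝ)).smulRight (q i)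

lemma frameMap_apply (q : ι → V) (u : EuclideanSpace ℝ κ) (x : EuclideanSpace ℝ (ι × κ)) :
    frameMap q u x = ∑ i, (∑ j, u j * x (i, j)) • q i := by
  simp [frameMap, Finset.sum_smul]

lemma frameMap_single [DecidableEq ι] [DecidableEq κ] (q : ι → V) (u : EuclideanSpace ℝ κ)
    (p : ι × κ) : frameMap q u (EuclideanSpace.single p 1) = u p.2 • q p.1 := by
  rw [frameMap_apply, Finset.sum_eq_single p.1]
  · congr 1
    rw [Finset.sum_eq_single p.2] <;> simp +contextual [Prod.ext_iff]
  · intro i _ hi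
    simp [Prod.ext_iff, hi]
  · simp

/-- The Gaussian process `u ↦ (A u, γ)` of the comparison, as a linear image of `(A, γ)`. -/
noncomputable def gordonLeft (q : ι → V) (e : U → EuclideanSpace ℝ κ) :
    WithLp 2 (EuclideanSpace ℝ (ι × κ) × ℝ) →L[ℝ] (U → V × ℝ) :=
  ContinuousLinearMap.pi fun u =>
    ((frameMap q (e u)).comp (WithLp.fstL 2 ℝ _ _)).prod (WithLp.sndL 2 ℝ _ _)

/-- The Gaussian process `u ↦ (h, ⟪u, g⟫)` of the comparison, as a linear image of `(h, g)`. -/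
noncomputable def gordonRight (e : U → EuclideanSpace ℝ κ) :
    WithLp 2 (V × EuclideanSpace ℝ κ) →L[ℝ] (U → V × ℝ) :=
  ContinuousLinearMap.pi fun u =>
    (WithLp.fstL 2 ℝ _ _).prod ((innerSL ℝ (e u)).comp (WithLp.sndL 2 ℝ _ _))

omit [Fintype U] in
lemma gordonLeft_apply (q : ι → V) (e : U → EuclideanSpace ℝ κ)
    (x : WithLp 2 (EuclideanSpace ℝ (ι × κ) × ℝ)) (u : U) :
    gordonLeft q e x u = (frameMap q (e u) x.fst, x.snd) := rfl

omit [Fintype U] in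
lemma gordonRight_apply (e : U → EuclideanSpace ℝ κ) (y : WithLp 2 (V × EuclideanSpace ℝ κ))
    (u : U) : gordonRight e y u = (y.fst, ⟪e u, y.snd⟫) := rfl

omit [Fintype U] in
lemma gordonLeft_basis_inl [DecidableEq ι] [DecidableEq κ] (q : ι → V)
    (e : U → EuclideanSpace ℝ κ) (p : ι × κ) (u : U) :
    gordonLeft q e (((EuclideanSpace.basisFun (ι × κ) ℝ).prod
      (OrthonormalBasis.singleton Unit ℝ)) (Sum.inl p)) u = (e u p.2 • q p.1, 0) := by
  simp [gordonLeft_apply, frameMap_single]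

omit [Fintype U] in
lemma gordonLeft_basis_inr (q : ι → V) (e : U → EuclideanSpace ℝ κ) (p : Unit) (u : U) :
    gordonLeft q e (((EuclideanSpace.basisFun (ι × κ) ℝ).prod
      (OrthonormalBasis.singleton Unit ℝ)) (Sum.inr p)) u = (0, 1) := by
  simp [gordonLeft_apply]

omit [Fintype U] in
lemma gordonRight_basis_inl (b : OrthonormalBasis ι ℝ V) (e : U → EuclideanSpace ℝ κ) (k : ι)
    (u : U) : gordonRight e ((b.prod (EuclideanSpace.basisFun κ ℝ)) (Sum.inl k)) u = (b k, 0) := by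
  simp [gordonRight_apply]

omit [Fintype U] in
lemma gordonRight_basis_inr (b : OrthonormalBasis ι ℝ V) (e : U → EuclideanSpace ℝ κ) (j : κ)
    (u : U) :
    gordonRight e ((b.prod (EuclideanSpace.basisFun κ ℝ)) (Sum.inr j)) u = (0, e u j) := by
  classical
  simp [gordonRight_apply, EuclideanSpace.inner_single_right]

/-- The trace of the Hessian of `gordonFun` along a family of directions, with the square of the
sum over `u` expanded so that only covariances of the family enter. -/
lemma sum_gordonHess {I : Type*} [Fintype I] (c η δ : ℝ) (z : U → V × ℝ) (d : I → U → V × ℝ) :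
    ∑ i, gordonHess c η δ z (d i) =
      η * c ^ 2 * partitionSum c δ z ^ (η - 2) * (η - 1) *
        (∑ u, ∑ v, Real.exp (c * shiftedNorm δ (z u)) * Real.exp (c * shiftedNorm δ (z v)) *
          ∑ i, shiftedNormDeriv δ (z u) (d i u) * shiftedNormDeriv δ (z v) (d i v)) +
      η * c * partitionSum c δ z ^ (η - 1) * ∑ u, Real.exp (c * shiftedNorm δ (z u)) *
        (c * ∑ i, shiftedNormDeriv δ (z u) (d i u) ^ 2 +
          ∑ i, shiftedNormHess δ (z u) (d i u)) := by
  have hsq : ∑ i, (∑ u, Real.exp (c * shiftedNorm δ (z u)) *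
        shiftedNormDeriv δ (z u) (d i u)) ^ 2 =
      ∑ u, ∑ v, Real.exp (c * shiftedNorm δ (z u)) * Real.exp (c * shiftedNorm δ (z v)) *
        ∑ i, shiftedNormDeriv δ (z u) (d i u) * shiftedNormDeriv δ (z v) (d i v) := by
    simp_rw [sq, Finset.sum_mul_sum, Finset.mul_sum]
    rw [Finset.sum_comm]
    refine Finset.sum_congr rfl fun u _ => ?_
    rw [Finset.sum_comm]
    exact Finset.sum_congr rfl fun v _ => Finset.sum_congr rfl fun i _ => by ring
  have hlin : ∑ i, ∑ u, Real.exp (c * shiftedNorm δ (z u)) *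
        (c * shiftedNormDeriv δ (z u) (d i u) ^ 2 + shiftedNormHess δ (z u) (d i u)) =
      ∑ u, Real.exp (c * shiftedNorm δ (z u)) * (c * ∑ i, shiftedNormDeriv δ (z u) (d i u) ^ 2 +
        ∑ i, shiftedNormHess δ (z u) (d i u)) := by
    rw [Finset.sum_comm]
    refine Finset.sum_congr rfl fun u _ => ?_
    rw [← Finset.mul_sum, Finset.sum_add_distrib, Finset.mul_sum]
  rw [← hsq, ← hlin, Finset.mul_sum, Finset.mul_sum, ← Finset.sum_add_distrib]
  exact Finset.sum_congr rfl fun i _ => by rw [gordonHess]; ring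

/-- Monotonicity of the Hessian trace of `gordonFun` in the covariance of the process, when the
variances agree: for `0 ≤ η ≤ 1` the off-diagonal second derivatives are nonpositive. -/
lemma sum_gordonHess_le {I J : Type*} [Fintype I] [Fintype J] {c η δ : ℝ} (hη : 0 ≤ η)
    (hη1 : η ≤ 1) (z : U → V × ℝ) (d : I → U → V × ℝ) (d' : J → U → V × ℝ)
    (hoff : ∀ u v, ∑ j, shiftedNormDeriv δ (z u) (d' j u) * shiftedNormDeriv δ (z v) (d' j v) ≤
      ∑ i, shiftedNormDeriv δ (z u) (d i u) * shiftedNormDeriv δ (z v) (d i v))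
    (hdiag : ∀ u, ∑ i, shiftedNormDeriv δ (z u) (d i u) ^ 2 =
      ∑ j, shiftedNormDeriv δ (z u) (d' j u) ^ 2)
    (hhess : ∀ u, ∑ i, shiftedNormHess δ (z u) (d i u) = ∑ j, shiftedNormHess δ (z u) (d' j u)) :
    ∑ i, gordonHess c η δ z (d i) ≤ ∑ j, gordonHess c η δ z (d' j) := by
  have hG : 0 ≤ partitionSum c δ z := Finset.sum_nonneg fun u _ => Real.exp_nonneg _
  rw [sum_gordonHess, sum_gordonHess]
  simp_rw [hdiag, hhess]
  have h1 : η * c ^ 2 * partitionSum c δ z ^ (η - 2) * (η - 1) ≤ 0 :=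
    mul_nonpos_of_nonneg_of_nonpos (by positivity) (by linarith)
  gcongr ?_ + _
  refine mul_le_mul_of_nonpos_left ?_ h1
  refine Finset.sum_le_sum fun u _ => Finset.sum_le_sum fun v _ => ?_
  exact mul_le_mul_of_nonneg_left (hoff u v) (by positivity)

variable [FiniteDimensional ℝ V] [MeasurableSpace V] [BorelSpace V]

/-- Gordon's comparison inequality in exponential form. The covariances of the two processes differ
by `(1 - ⟪u, v⟫) * (1 - ⟪w, w'⟫) ≥ 0`, where `w` and `w'` are the gradients of the smoothed norm at
the values of the process at `u` and `v`; this vanishes for `u = v`. -/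
theorem integral_gordonFun_le [Nonempty U] {q : ι → V} (hq : IsParsevalFrame q)
    (e : U → EuclideanSpace ℝ κ) (he : ∀ u, ‖e u‖ = 1) {c η δ : ℝ} (hη : 0 ≤ η) (hη1 : η ≤ 1)
    (hδ : 0 < δ) :
    ∫ x, gordonFun c η δ (gordonLeft q e x)
        ∂stdGaussian (WithLp 2 (EuclideanSpace ℝ (ι × κ) × ℝ)) ≤
      ∫ y, gordonFun c η δ (gordonRight (V := V) e y)
        ∂stdGaussian (WithLp 2 (V × EuclideanSpace ℝ κ)) := by
  classical
  have b := stdOrthonormalBasis ℝ V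
  refine (isSmoothExpGrowth_gordonFun hη hδ).integral_le_of_trace_le
    ((EuclideanSpace.basisFun (ι × κ) ℝ).prod (OrthonormalBasis.singleton Unit ℝ))
    (b.prod (EuclideanSpace.basisFun κ ℝ)) _ _ fun z => ?_
  have hρ : ∀ u, 0 < smoothNorm δ (z u).1 := fun u => smoothNorm_pos hδ _
  -- the covariances of the derivatives of `shiftedNorm` along the two processes
  have hL : ∀ u v, ∑ i, shiftedNormDeriv δ (z u) (gordonLeft q e
        (((EuclideanSpace.basisFun (ι × κ) ℝ).prod (OrthonormalBasis.singleton Unit ℝ)) i) u) *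
      shiftedNormDeriv δ (z v) (gordonLeft q e
        (((EuclideanSpace.basisFun (ι × κ) ℝ).prod (OrthonormalBasis.singleton Unit ℝ)) i) v) =
      ⟪e u, e v⟫ * (⟪(z u).1, (z v).1⟫ / (smoothNorm δ (z u).1 * smoothNorm δ (z v).1)) + 1 := by
    intro u v
    rw [Fintype.sum_sum_type, ← hq, Fintype.sum_prod_type]
    simp only [gordonLeft_basis_inl, gordonLeft_basis_inr, shiftedNormDeriv_apply, inner_smul_right,
      inner_zero_right, zero_div, zero_add, add_zero, PiLp.inner_apply, Finset.sum_div,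
      Finset.sum_mul_sum, Finset.univ_unique, Finset.sum_const, Finset.card_singleton, one_smul,
      mul_one]
    congr 1
    rw [Finset.sum_comm]
    refine Finset.sum_congr rfl fun i _ => Finset.sum_congr rfl fun j _ => ?_
    simp only [RCLike.inner_apply, conj_trivial]
    have := (hρ u).ne'
    have := (hρ v).ne'
    field_simp
  have hR : ∀ u v, ∑ i, shiftedNormDeriv δ (z u) (gordonRight e
        ((b.prod (EuclideanSpace.basisFun κ ℝ)) i) u) *
      shiftedNormDeriv δ (z v) (gordonRight e ((b.prod (EuclideanSpace.basisFun κ ℝ)) i) v) =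
      ⟪(z u).1, (z v).1⟫ / (smoothNorm δ (z u).1 * smoothNorm δ (z v).1) + ⟪e u, e v⟫ := by
    intro u v
    rw [Fintype.sum_sum_type, ← b.sum_inner_mul_inner]
    simp only [gordonRight_basis_inl, gordonRight_basis_inr, shiftedNormDeriv_apply,
      inner_zero_right, zero_div, zero_add, add_zero, PiLp.inner_apply, Finset.sum_div]
    congr 1
    · refine Finset.sum_congr rfl fun i _ => ?_
      rw [real_inner_comm (b i) (z v).1, div_mul_div_comm]
    · refine Finset.sum_congr rfl fun i _ => ?_
      simp [mul_comm]
  have hself : ∀ u, ⟪e u, e u⟫ = 1 := fun u => by rw [real_inner_self_eq_norm_sq, he]; norm_num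
  refine sum_gordonHess_le hη hη1 z _ _ (fun u v => ?_) (fun u => ?_) fun u => ?_
  · rw [hL, hR]
    have h1 : ⟪e u, e v⟫ ≤ 1 := by
      simpa [he] using real_inner_le_norm (e u) (e v)
    have h2 : ⟪(z u).1, (z v).1⟫ / (smoothNorm δ (z u).1 * smoothNorm δ (z v).1) ≤ 1 := by
      rw [div_le_one (mul_pos (hρ u) (hρ v))]
      exact (real_inner_le_norm _ _).trans (mul_le_mul (norm_le_smoothNorm _ _)
        (norm_le_smoothNorm _ _) (norm_nonneg _) (hρ u).le)
    nlinarith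
  · simp_rw [sq]
    rw [hL, hR, hself]
    ring
  · simp_rw [shiftedNormHess]
    rw [← Finset.sum_div, ← Finset.sum_div, Finset.sum_sub_distrib, Finset.sum_sub_distrib]
    have h1 : ∑ j, e u j ^ 2 = 1 := by
      rw [← EuclideanSpace.real_norm_sq_eq, he]; norm_num
    have h4 := hL u u
    have h5 := hR u u
    rw [Fintype.sum_sum_type] at h4 h5
    simp only [gordonLeft_basis_inl, gordonLeft_basis_inr, gordonRight_basis_inl,
      gordonRight_basis_inr, shiftedNormDeriv_apply, inner_zero_right, zero_div, zero_add, add_zero,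
      hself, ← sq, h1, one_mul, one_pow, Finset.univ_unique, Finset.sum_const,
      Finset.card_singleton, one_smul] at h4 h5
    congr 2
    · rw [Fintype.sum_sum_type, Fintype.sum_sum_type, Fintype.sum_prod_type]
      simp only [gordonLeft_basis_inl, gordonLeft_basis_inr, gordonRight_basis_inl,
        gordonRight_basis_inr, norm_smul, mul_pow, b.orthonormal.1, norm_zero, Real.norm_eq_abs,
        sq_abs]
      simp_rw [← Finset.sum_mul, h1, one_mul, hq.sum_norm_sq]
      simp
    · rw [Fintype.sum_sum_type, Fintype.sum_sum_type]
      simp only [gordonLeft_basis_inl, gordonLeft_basis_inr, gordonRight_basis_inl,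
        gordonRight_basis_inr, inner_zero_right, zero_div]
      simp only [Finset.sum_const_zero, zero_pow two_ne_zero]
      linarith

end Comparison

/-! ### Concentration of the extreme values of a Gaussian frame map -/

section FiniteTail

variable {V : Type*} [NormedAddCommGroup V] [InnerProductSpace ℝ V]
  [FiniteDimensional ℝ V] [MeasurableSpace V] [BorelSpace V]
  {U ι κ : Type*} [Fintype U] [Fintype ι] [Fintype κ]

omit [InnerProductSpace ℝ V] [FiniteDimensional ℝ V] [MeasurableSpace V] [BorelSpace V] in
lemma abs_mul_smoothNorm_sub_le {δ : ℝ} (hδ : 0 < δ) (t : ℝ) (z : V) :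
    |t * smoothNorm δ z - t * ‖z‖| ≤ |t| * δ := by
  rw [← mul_sub, abs_mul]
  gcongr
  rw [abs_of_nonneg (by linarith [norm_le_smoothNorm δ z])]
  linarith [smoothNorm_le hδ z]

omit [InnerProductSpace ℝ V] [FiniteDimensional ℝ V] [MeasurableSpace V] [BorelSpace V] in
lemma exp_le_gordonFun {t η : ℝ} (hη : 0 < η) (z : U → V × ℝ) (u : U) :
    Real.exp (t * ‖(z u).1‖ - |t| * η + t * (z u).2) ≤ gordonFun (t / η) η η z := by
  have h := abs_le.1 (abs_mul_smoothNorm_sub_le hη t (z u).1)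
  have h1 : Real.exp (t * ‖(z u).1‖ - |t| * η + t * (z u).2) ≤
      Real.exp (t / η * shiftedNorm η (z u)) ^ η := by
    rw [← Real.exp_mul, Real.exp_le_exp, shiftedNorm]
    have : t / η * (smoothNorm η (z u).1 + (z u).2) * η = t * smoothNorm η (z u).1 + t * (z u).2 := by
      field_simp
    rw [this]
    linarith
  refine h1.trans (Real.rpow_le_rpow (Real.exp_nonneg _) ?_ hη.le)
  exact Finset.single_le_sum (f := fun u => Real.exp (t / η * shiftedNorm η (z u)))
    (fun _ _ => Real.exp_nonneg _) (Finset.mem_univ u)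

omit [FiniteDimensional ℝ V] [MeasurableSpace V] [BorelSpace V] in
lemma gordonFun_gordonRight_le {t η : ℝ} (hη : 0 < η) (e : U → EuclideanSpace ℝ κ)
    (he : ∀ u, ‖e u‖ = 1) (y : WithLp 2 (V × EuclideanSpace ℝ κ)) :
    gordonFun (t / η) η η (gordonRight e y) ≤
      (Fintype.card U : ℝ) ^ η * Real.exp (|t| * η) *
        (Real.exp (t * ‖y.fst‖) * Real.exp (|t| * ‖y.snd‖)) := by
  have h : partitionSum (t / η) η (gordonRight e y) ≤
      Fintype.card U * Real.exp ((|t| * η + (t * ‖y.fst‖ + |t| * ‖y.snd‖)) / η) := by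
    refine (Finset.sum_le_card_nsmul _ _
      (Real.exp ((|t| * η + (t * ‖y.fst‖ + |t| * ‖y.snd‖)) / η)) fun u _ => ?_).trans_eq (by simp)
    rw [Real.exp_le_exp, gordonRight_apply, shiftedNorm, div_mul_eq_mul_div]
    gcongr
    have h1 := abs_le.1 (abs_mul_smoothNorm_sub_le hη t y.fst)
    have h2 : t * ⟪e u, y.snd⟫ ≤ |t| * ‖y.snd‖ := by
      refine (le_abs_self _).trans ?_
      rw [abs_mul]
      gcongr
      simpa [he] using abs_real_inner_le_norm (e u) y.snd
    rw [mul_add]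
    linarith
  refine (Real.rpow_le_rpow (Finset.sum_nonneg fun u _ => Real.exp_nonneg _) h hη.le).trans_eq ?_
  rw [Real.mul_rpow (by positivity) (Real.exp_nonneg _), ← Real.exp_mul, div_mul_cancel₀ _ hη.ne',
    Real.exp_add, Real.exp_add, mul_assoc]

/-- Tail bound for finitely many directions: for `t > 0` it controls the largest of the norms
`‖A u‖` from above, for `t < 0` the smallest one from below. -/
lemma measureReal_exists_frameMap_le [Nonempty U] {q : ι → V} (hq : IsParsevalFrame q)
    (e : U → EuclideanSpace ℝ κ) (he : ∀ u, ‖e u‖ = 1) (t a : ℝ) :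
    (stdGaussian (EuclideanSpace ℝ (ι × κ))).real {x | ∃ u, t * a ≤ t * ‖frameMap q (e u) x‖} ≤
      Real.exp (-(t * a) - t ^ 2 / 2) * ((∫ h : V, Real.exp (t * ‖h‖) ∂stdGaussian V) *
        ∫ g, Real.exp (|t| * ‖g‖) ∂stdGaussian (EuclideanSpace ℝ κ)) := by
  set A := {x : EuclideanSpace ℝ (ι × κ) | ∃ u, t * a ≤ t * ‖frameMap q (e u) x‖} with hA
  set M := (∫ h : V, Real.exp (t * ‖h‖) ∂stdGaussian V) *
        ∫ g, Real.exp (|t| * ‖g‖) ∂stdGaussian (EuclideanSpace ℝ κ) with hM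
  have hAm : MeasurableSet A := by
    have : A = ⋃ u, {x | t * a ≤ t * ‖frameMap q (e u) x‖} := by ext; simp [A]
    rw [this]
    exact MeasurableSet.iUnion fun u => measurableSet_le measurable_const (by fun_prop)
  -- the smoothing parameter is `δ = η` and the inverse temperature is `c = t / η`, so that
  -- `gordonFun` tends to the exponential of `t` times the extremum as `η → 0`
  have key : ∀ η : ℝ, 0 < η → η ≤ 1 → (stdGaussian (EuclideanSpace ℝ (ι × κ))).real A ≤
      Real.exp (-(t * a) - t ^ 2 / 2) * ((Fintype.card U : ℝ) ^ η * Real.exp (2 * |t| * η) * M) := by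
    intro η hη hη1
    have hsm := isSmoothExpGrowth_gordonFun (U := U) (V := V) (c := t / η) hη.le hη
    have hc : Continuous (gordonFun (t / η) η η : (U → V × ℝ) → ℝ) :=
      continuous_partitionSum_rpow _ _ _
    have hcL : Continuous fun x => gordonFun (t / η) η η (gordonLeft q e x) :=
      hc.comp (gordonLeft q e).continuous
    have hcR : Continuous fun y => gordonFun (t / η) η η (gordonRight (V := V) e y) :=
      hc.comp (gordonRight e).continuous
    have hg := integral_gordonFun_le hq e he (c := t / η) hη.le hη1 hη
    have hub : ∫ y, gordonFun (t / η) η η (gordonRight (V := V) e y)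
        ∂stdGaussian (WithLp 2 (V × EuclideanSpace ℝ κ)) ≤
        (Fintype.card U : ℝ) ^ η * Real.exp (|t| * η) * M := by
      have hprod := (integrable_exp_mul_norm_stdGaussian (E := V) t).mul_prod
        (integrable_exp_mul_norm_stdGaussian (E := EuclideanSpace ℝ κ) |t|)
      rw [stdGaussian_prod, integral_map (by fun_prop) hcR.aestronglyMeasurable]
      refine (integral_mono_of_nonneg (Filter.Eventually.of_forall fun p =>
          Real.rpow_nonneg (partitionSum_pos _ _ _).le _) (hprod.const_mul _)
        (Filter.Eventually.of_forall fun p => gordonFun_gordonRight_le hη e he _)).trans_eq ?_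
      rw [integral_const_mul]
      congr 1
      exact integral_prod_mul (μ := stdGaussian V) (ν := stdGaussian (EuclideanSpace ℝ κ))
        (fun h => Real.exp (t * ‖h‖)) (fun g => Real.exp (|t| * ‖g‖))
    have hlb : (stdGaussian (EuclideanSpace ℝ (ι × κ))).real A *
        (Real.exp (t * a - |t| * η) * Real.exp (t ^ 2 / 2)) ≤
        ∫ x, gordonFun (t / η) η η (gordonLeft q e x)
          ∂stdGaussian (WithLp 2 (EuclideanSpace ℝ (ι × κ) × ℝ)) := by
      rw [stdGaussian_prod, integral_map (by fun_prop) hcL.aestronglyMeasurable]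
      have e1 : (stdGaussian (EuclideanSpace ℝ (ι × κ))).real A *
          (Real.exp (t * a - |t| * η) * Real.exp (t ^ 2 / 2)) =
          ∫ p : EuclideanSpace ℝ (ι × κ) × ℝ, A.indicator (fun _ => (1 : ℝ)) p.1 *
            (Real.exp (t * a - |t| * η) * Real.exp (t * p.2))
            ∂(stdGaussian (EuclideanSpace ℝ (ι × κ))).prod (stdGaussian ℝ) := by
        rw [integral_prod_mul (A.indicator fun _ => (1 : ℝ))
          (fun s => Real.exp (t * a - |t| * η) * Real.exp (t * s)), integral_const_mul,
          integral_exp_mul_stdGaussian_real, integral_indicator_const _ hAm]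
        simp
      rw [e1]
      refine integral_mono_of_nonneg (Filter.Eventually.of_forall fun p => ?_) ?_
        (Filter.Eventually.of_forall fun p => ?_)
      · exact mul_nonneg (Set.indicator_nonneg (fun _ _ => zero_le_one) _) (by positivity)
      · have hi : Integrable (fun x => gordonFun (t / η) η η (gordonLeft q e x))
            (stdGaussian (WithLp 2 (EuclideanSpace ℝ (ι × κ) × ℝ))) := by
          refine integrable_stdGaussian_of_le_exp
            hcL.aestronglyMeasurable _
            (2 * η * |t / η| * ‖gordonLeft q e‖) fun x => (hsm.bound_zero _).trans
              ((hsm.exp_le ((gordonLeft q e).le_opNorm x)).trans_eq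
                (by rw [← mul_assoc (2 * η * |t / η|)]))
        rw [stdGaussian_prod] at hi
        exact hi.comp_measurable (by fun_prop)
      · by_cases hp : p.1 ∈ A
        · obtain ⟨u, hu⟩ := hp
          have hp : p.1 ∈ A := ⟨u, hu⟩
          simp only [hp, Set.indicator_of_mem, one_mul]
          rw [← Real.exp_add]
          refine le_trans (Real.exp_le_exp.2 ?_)
            (exp_le_gordonFun (t := t) hη (gordonLeft q e (WithLp.toLp 2 p)) u)
          change t * a - |t| * η + t * p.2 ≤
            t * ‖frameMap q (e u) p.1‖ - |t| * η + t * p.2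
          linarith
        · simp only [hp, not_false_eq_true, Set.indicator_of_notMem, zero_mul]
          exact Real.rpow_nonneg (partitionSum_pos _ _ _).le _
    have h3 := (hlb.trans hg).trans hub
    rw [← Real.exp_add, ← le_div_iff₀ (Real.exp_pos _)] at h3
    refine h3.trans_eq ?_
    rw [div_eq_mul_inv, ← Real.exp_neg, show -(t * a - |t| * η + t ^ 2 / 2) =
      (-(t * a) - t ^ 2 / 2) + |t| * η by ring, show 2 * |t| * η = |t| * η + |t| * η by ring,
      Real.exp_add, Real.exp_add]
    ring
  have hlim : Filter.Tendsto (fun η : ℝ => Real.exp (-(t * a) - t ^ 2 / 2) *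
      ((Fintype.card U : ℝ) ^ η * Real.exp (2 * |t| * η) * M)) (nhdsWithin 0 (Set.Ioi 0))
      (nhds (Real.exp (-(t * a) - t ^ 2 / 2) * M)) := by
    have hcard : (0 : ℝ) < Fintype.card U := by exact_mod_cast Fintype.card_pos
    have : Continuous fun η : ℝ => Real.exp (-(t * a) - t ^ 2 / 2) *
        ((Fintype.card U : ℝ) ^ η * Real.exp (2 * |t| * η) * M) := by
      have := Real.continuous_const_rpow hcard.ne'
      fun_prop
    have h := (this.tendsto 0).mono_left (nhdsWithin_le_nhds (s := Set.Ioi 0))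
    simpa using h
  refine ge_of_tendsto hlim ?_
  filter_upwards [Ioc_mem_nhdsGT (zero_lt_one' ℝ)] with η hη
  exact key η hη.1 hη.2

omit [MeasurableSpace V] [BorelSpace V] [FiniteDimensional ℝ V] [Fintype U] in
lemma continuous_frameMap_left (q : ι → V) (x : EuclideanSpace ℝ (ι × κ)) :
    Continuous fun u : EuclideanSpace ℝ κ => frameMap q u x := by
  simp only [frameMap_apply]
  fun_prop

/-- The tail bound for all directions, by exhausting the unit sphere with finite sets. -/
lemma measureReal_exists_unit_frameMap_le {q : ι → V} (hq : IsParsevalFrame q) (t a : ℝ) :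
    (stdGaussian (EuclideanSpace ℝ (ι × κ))).real
        {x | ∃ u : EuclideanSpace ℝ κ, ‖u‖ = 1 ∧ t * a < t * ‖frameMap q u x‖} ≤
      Real.exp (-(t * a) - t ^ 2 / 2) * ((∫ h : V, Real.exp (t * ‖h‖) ∂stdGaussian V) *
        ∫ g, Real.exp (|t| * ‖g‖) ∂stdGaussian (EuclideanSpace ℝ κ)) := by
  set R := Real.exp (-(t * a) - t ^ 2 / 2) * ((∫ h : V, Real.exp (t * ‖h‖) ∂stdGaussian V) *
        ∫ g, Real.exp (|t| * ‖g‖) ∂stdGaussian (EuclideanSpace ℝ κ)) with hR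
  have hR0 : 0 ≤ R := by
    have h1 : 0 ≤ ∫ h : V, Real.exp (t * ‖h‖) ∂stdGaussian V :=
      integral_nonneg fun _ => Real.exp_nonneg _
    have h2 : 0 ≤ ∫ g, Real.exp (|t| * ‖g‖) ∂stdGaussian (EuclideanSpace ℝ κ) :=
      integral_nonneg fun _ => Real.exp_nonneg _
    positivity
  rcases isEmpty_or_nonempty (Metric.sphere (0 : EuclideanSpace ℝ κ) 1) with hemp | hne
  · have : {x : EuclideanSpace ℝ (ι × κ) |
        ∃ u : EuclideanSpace ℝ κ, ‖u‖ = 1 ∧ t * a < t * ‖frameMap q u x‖} = ∅ := by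
      ext x
      simp only [Set.mem_ofPred_eq, Set.mem_empty_iff_false, iff_false]
      rintro ⟨u, hu, -⟩
      exact hemp.elim ⟨u, by simpa using hu⟩
    rw [this]
    simpa using hR0
  · let d := TopologicalSpace.denseSeq (Metric.sphere (0 : EuclideanSpace ℝ κ) 1)
    let S : ℕ → Set (EuclideanSpace ℝ (ι × κ)) := fun n =>
      {x | ∃ k : Fin (n + 1), t * a ≤ t * ‖frameMap q (d k : EuclideanSpace ℝ κ) x‖}
    have hmono : Monotone S := by
      rintro m n hmn x ⟨k, hk⟩
      exact ⟨⟨k, k.2.trans_le (by omega)⟩, hk⟩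
    have hsub : {x : EuclideanSpace ℝ (ι × κ) |
        ∃ u : EuclideanSpace ℝ κ, ‖u‖ = 1 ∧ t * a < t * ‖frameMap q u x‖} ⊆ ⋃ n, S n := by
      rintro x ⟨u, hu, hlt⟩
      have hopen : IsOpen {v : Metric.sphere (0 : EuclideanSpace ℝ κ) 1 |
          t * a < t * ‖frameMap q (v : EuclideanSpace ℝ κ) x‖} := by
        have := continuous_frameMap_left (κ := κ) q x
        exact isOpen_lt continuous_const (by fun_prop)
      obtain ⟨k, hk⟩ := (TopologicalSpace.denseRange_denseSeq
        (Metric.sphere (0 : EuclideanSpace ℝ κ) 1)).exists_mem_open hopen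
        ⟨⟨u, by simpa using hu⟩, hlt⟩
      exact Set.mem_iUnion.2 ⟨k, ⟨k, Nat.lt_succ_self k⟩, le_of_lt hk⟩
    have hle : (stdGaussian (EuclideanSpace ℝ (ι × κ))) (⋃ n, S n) ≤ ENNReal.ofReal R := by
      rw [hmono.measure_iUnion]
      refine iSup_le fun n => ?_
      rw [← ENNReal.ofReal_toReal (measure_ne_top (stdGaussian _) (S n))]
      exact ENNReal.ofReal_le_ofReal (measureReal_exists_frameMap_le hq
        (fun k : Fin (n + 1) => (d k : EuclideanSpace ℝ κ)) (fun k => by simp) t a)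
    exact ENNReal.toReal_le_of_le_ofReal hR0 ((measure_mono hsub).trans hle)

/-- Upper tail of the largest singular value of a standard Gaussian matrix. -/
lemma measureReal_exists_lt_norm_frameMap_le {q : ι → V} (hq : IsParsevalFrame q) {t : ℝ}
    (ht : 0 < t) :
    (stdGaussian (EuclideanSpace ℝ (ι × κ))).real {x | ∃ u : EuclideanSpace ℝ κ, ‖u‖ = 1 ∧
        √(Module.finrank ℝ V) + √(Fintype.card κ) + t < ‖frameMap q u x‖} ≤
      Real.exp (-(t ^ 2 / 2)) := by
  have h := measureReal_exists_unit_frameMap_le (κ := κ) hq t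
    (√(Module.finrank ℝ V) + √(Fintype.card κ) + t)
  simp only [mul_lt_mul_iff_right₀ ht, abs_of_pos ht] at h
  have h1 := integral_exp_mul_norm_le V t ht.le
  have h2 := integral_exp_mul_norm_le (EuclideanSpace ℝ κ) t ht.le
  rw [finrank_euclideanSpace] at h2
  refine h.trans ((mul_le_mul_of_nonneg_left (mul_le_mul h1 h2
    (integral_nonneg fun _ => Real.exp_nonneg _) (Real.exp_nonneg _))
    (Real.exp_nonneg _)).trans_eq ?_)
  rw [← Real.exp_add, ← Real.exp_add]
  congr 1
  ring

/-- Lower tail of the smallest singular value of a standard Gaussian matrix. -/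
lemma measureReal_exists_norm_frameMap_lt_le {q : ι → V} (hq : IsParsevalFrame q)
    (hdim : 14 ≤ Module.finrank ℝ V) {t : ℝ} (ht : 1 ≤ t) :
    (stdGaussian (EuclideanSpace ℝ (ι × κ))).real {x | ∃ u : EuclideanSpace ℝ κ, ‖u‖ = 1 ∧
        ‖frameMap q u x‖ < √(Module.finrank ℝ V) - √(Fintype.card κ) - t} ≤
      Real.exp (-(t ^ 2 / 2)) := by
  have ht0 : 0 < t := by linarith
  have h := measureReal_exists_unit_frameMap_le (κ := κ) hq (-t)
    (√(Module.finrank ℝ V) - √(Fintype.card κ) - t)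
  simp only [neg_mul, neg_lt_neg_iff, mul_lt_mul_iff_right₀ ht0, abs_neg, abs_of_pos ht0] at h
  have h1 := integral_exp_neg_mul_norm_le V hdim t ht
  have h2 := integral_exp_mul_norm_le (EuclideanSpace ℝ κ) t ht0.le
  rw [finrank_euclideanSpace] at h2
  simp only [neg_mul] at h1
  refine h.trans ((mul_le_mul_of_nonneg_left (mul_le_mul h1 h2
    (integral_nonneg fun _ => Real.exp_nonneg _) (Real.exp_nonneg _))
    (Real.exp_nonneg _)).trans_eq ?_)
  rw [← Real.exp_add, ← Real.exp_add]
  congr 1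
  ring

end FiniteTail

/-! ### Positive definiteness from two-sided quadratic form bounds -/

section Deterministic

variable {p r : ℕ}

lemma inner_vec_eq_trace (A B : Matrix (Fin p) (Fin p) ℝ) (hA : A.IsSymm) :
    A.vec ⬝ᵥ B.vec = (A * B).trace := by
  rw [Matrix.vec_dotProduct_vec, hA.eq]

lemma designMatrix_mulVec (G : Fin r → Matrix (Fin p) (Fin p) ℝ) (v : Fin r → ℝ) :
    designMatrix G *ᵥ v = (∑ i, v i • G i).vec := by
  ext ab
  simp [designMatrix, Matrix.mulVec, dotProduct, Matrix.vec, Matrix.sum_apply, mul_comm]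

/-- The normal equations for the least squares estimator. -/
lemma vec_dotProduct_leastSquares {G : Fin r → Matrix (Fin p) (Fin p) ℝ}
    (hlin : LinearIndependent ℝ G) (S : Matrix (Fin p) (Fin p) ℝ) (j : Fin r) :
    (G j).vec ⬝ᵥ (∑ i, leastSquares G S i • G i).vec = (G j).vec ⬝ᵥ S.vec := by
  have hinj : Function.Injective (designMatrix G).mulVec := by
    intro v w h
    have h' : designMatrix G *ᵥ v = designMatrix G *ᵥ w := h
    rw [designMatrix_mulVec, designMatrix_mulVec, Matrix.vec_inj] at h'
    exact Fintype.linearIndependent_iffₛ.1 hlin v w h' |> funext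
  have hunit : IsUnit ((designMatrix G)ᵀ * designMatrix G).det := by
    have := (Matrix.PosDef.conjTranspose_mul_self (designMatrix G) hinj).isUnit
    rw [Matrix.conjTranspose_eq_transpose_of_trivial] at this
    exact (Matrix.isUnit_iff_isUnit_det _).1 this
  have h : (designMatrix G)ᵀ *ᵥ (designMatrix G *ᵥ leastSquares G S) =
      (designMatrix G)ᵀ *ᵥ S.vec := by
    rw [Matrix.mulVec_mulVec, leastSquares, Matrix.mulVec_mulVec, Matrix.mul_nonsing_inv _ hunit,
      Matrix.one_mulVec]
  rw [designMatrix_mulVec] at h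
  exact congrFun h j

lemma abs_dotProduct_mulVec_le_frobenius (A : Matrix (Fin p) (Fin p) ℝ) (u : Fin p → ℝ) :
    |u ⬝ᵥ A *ᵥ u| ≤ √(A.vec ⬝ᵥ A.vec) * (u ⬝ᵥ u) := by
  have hu : 0 ≤ u ⬝ᵥ u := Finset.sum_nonneg fun i _ => mul_self_nonneg (u i)
  have hA : 0 ≤ A.vec ⬝ᵥ A.vec := Finset.sum_nonneg fun i _ => mul_self_nonneg (A.vec i)
  refine abs_le_of_sq_le_sq ?_ (by positivity)
  rw [mul_pow, Real.sq_sqrt hA]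
  have h1 : u ⬝ᵥ A *ᵥ u = ∑ ab : Fin p × Fin p, A.vec ab * (u ab.2 * u ab.1) := by
    rw [Fintype.sum_prod_type_right]
    simp only [dotProduct, Matrix.mulVec, Matrix.vec, Finset.mul_sum]
    exact Finset.sum_congr rfl fun i _ => Finset.sum_congr rfl fun j _ => by ring
  have h2 : (u ⬝ᵥ u) ^ 2 = ∑ ab : Fin p × Fin p, (u ab.2 * u ab.1) ^ 2 := by
    rw [sq, Fintype.sum_prod_type_right]
    simp only [dotProduct, Finset.sum_mul_sum]
    exact Finset.sum_congr rfl fun i _ => Finset.sum_congr rfl fun j _ => by ring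
  rw [h1, h2]
  refine (Finset.sum_mul_sq_le_sq_mul_sq _ _ _).trans_eq ?_
  simp only [dotProduct, sq]

/-- A symmetric matrix whose quadratic form is bounded by `c` has Frobenius norm at most `√p c`. -/
lemma frobenius_sq_le {E : Matrix (Fin p) (Fin p) ℝ} (hE : E.IsSymm) {c : ℝ} (hc : 0 < c)
    (h : ∀ u, |u ⬝ᵥ E *ᵥ u| ≤ c * (u ⬝ᵥ u)) : E.vec ⬝ᵥ E.vec ≤ p * c ^ 2 := by
  have hrow : ∀ j, (E *ᵥ Pi.single j 1) ⬝ᵥ (E *ᵥ Pi.single j 1) ≤ c ^ 2 := by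
    intro j
    set x : Fin p → ℝ := Pi.single j 1 with hx
    have hxx : x ⬝ᵥ x = 1 := by simp [hx]
    set y := E *ᵥ x with hy
    have hsym : x ⬝ᵥ E *ᵥ y = y ⬝ᵥ y := by
      rw [Matrix.dotProduct_mulVec, ← Matrix.mulVec_transpose, hE.eq]
    -- polarization of the quadratic form at `x` and `c⁻¹ • E x`
    have h1 := (abs_le.1 (h (x + c⁻¹ • y))).2
    have h2 := (abs_le.1 (h (x - c⁻¹ • y))).1
    have hyx : y ⬝ᵥ E *ᵥ x = y ⬝ᵥ y := rfl
    simp only [Matrix.mulVec_add, Matrix.mulVec_sub, Matrix.mulVec_smul, dotProduct_add,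
      dotProduct_sub, add_dotProduct, sub_dotProduct, dotProduct_smul, smul_dotProduct,
      smul_eq_mul, hsym, hyx, hxx, dotProduct_comm y x] at h1 h2
    have h3 : 4 * (c⁻¹ * (y ⬝ᵥ y)) ≤ c * (2 + 2 * (c⁻¹ * (c⁻¹ * (y ⬝ᵥ y)))) := by linarith
    have h4 : c * (2 + 2 * (c⁻¹ * (c⁻¹ * (y ⬝ᵥ y)))) = 2 * c + 2 * (c⁻¹ * (y ⬝ᵥ y)) := by
      field_simp
    rw [h4] at h3
    have h5 : c⁻¹ * (y ⬝ᵥ y) ≤ c := by linarith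
    rw [inv_mul_le_iff₀ hc] at h5
    linarith
  have he : E.vec ⬝ᵥ E.vec = ∑ j, (E *ᵥ Pi.single j 1) ⬝ᵥ (E *ᵥ Pi.single j 1) := by
    simp only [dotProduct, Matrix.vec, Fintype.sum_prod_type, Matrix.mulVec_single_one,
      Matrix.col_apply]
  rw [he]
  exact (Finset.sum_le_card_nsmul _ _ _ fun j _ => hrow j).trans_eq (by simp)

lemma dotProduct_mulVec_le_spectralNorm (A : Matrix (Fin p) (Fin p) ℝ) (u : Fin p → ℝ) :
    u ⬝ᵥ A *ᵥ u ≤ spectralNorm A * (u ⬝ᵥ u) := by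
  have h := real_inner_le_norm (WithLp.toLp 2 u)
    (Matrix.toEuclideanCLM (n := Fin p) (𝕜 := ℝ) A (WithLp.toLp 2 u))
  rw [Matrix.inner_toEuclideanCLM] at h
  refine h.trans ?_
  have h1 := (Matrix.toEuclideanCLM (n := Fin p) (𝕜 := ℝ) A).le_opNorm (WithLp.toLp 2 u)
  have h2 : u ⬝ᵥ u = ‖WithLp.toLp 2 u‖ * ‖WithLp.toLp 2 u‖ := by
    rw [← sq, EuclideanSpace.real_norm_sq_eq]
    simp [dotProduct, sq]
  rw [h2, spectralNorm]
  nlinarith [norm_nonneg (WithLp.toLp 2 u)]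

/-- `uᵀu ≤ ‖A⁻¹‖ uᵀAu` for positive definite `A`. -/
lemma dotProduct_self_le_spectralNorm_inv {A : Matrix (Fin p) (Fin p) ℝ} (hA : A.PosDef)
    (u : Fin p → ℝ) : u ⬝ᵥ u ≤ spectralNorm A⁻¹ * (u ⬝ᵥ A *ᵥ u) := by
  have hdet : IsUnit A.det := (Matrix.isUnit_iff_isUnit_det _).1 hA.isUnit
  set l := spectralNorm A⁻¹ with hl
  have hl0 : 0 ≤ l := norm_nonneg _
  rcases hl0.eq_or_lt with h0 | hpos
  · have hz : A⁻¹ = 0 := by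
      have : Matrix.toEuclideanCLM (n := Fin p) (𝕜 := ℝ) A⁻¹ = 0 := norm_eq_zero.1 h0.symm
      simpa using this
    have hu : u = 0 := by
      rw [← Matrix.one_mulVec u, ← Matrix.mul_nonsing_inv A hdet, hz]; simp
    simp [hu]
  · set w := A⁻¹ *ᵥ u with hw
    have hAw : A *ᵥ w = u := by
      rw [hw, Matrix.mulVec_mulVec, Matrix.mul_nonsing_inv A hdet, Matrix.one_mulVec]
    have hsym : Aᵀ = A := by
      rw [← Matrix.conjTranspose_eq_transpose_of_trivial]; exact hA.isHermitian
    have hwAu : w ⬝ᵥ A *ᵥ u = u ⬝ᵥ u := by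
      rw [Matrix.dotProduct_mulVec, ← Matrix.mulVec_transpose, hsym, hAw]
    have hwu : u ⬝ᵥ w ≤ l * (u ⬝ᵥ u) := dotProduct_mulVec_le_spectralNorm _ _
    have hnn : 0 ≤ (u - l⁻¹ • w) ⬝ᵥ A *ᵥ (u - l⁻¹ • w) := by
      have := hA.posSemidef.dotProduct_mulVec_nonneg (u - l⁻¹ • w)
      simpa using this
    simp only [Matrix.mulVec_sub, Matrix.mulVec_smul, dotProduct_sub, sub_dotProduct,
      dotProduct_smul, smul_dotProduct, smul_eq_mul, hAw, hwAu, dotProduct_comm w u] at hnn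
    have h1 : l⁻¹ * (l⁻¹ * (u ⬝ᵥ w)) ≤ l⁻¹ * (u ⬝ᵥ u) := by
      refine mul_le_mul_of_nonneg_left ?_ (by positivity)
      rw [inv_mul_le_iff₀ hpos]; exact hwu
    have h2 : l⁻¹ * (u ⬝ᵥ u) ≤ u ⬝ᵥ A *ᵥ u := by linarith
    rwa [inv_mul_le_iff₀ hpos] at h2

/-- If the quadratic form of `S` lies between `(1 ± x)` times that of the true covariance matrix
with `x = 1 / (1 + κ √p)`, both positive definiteness claims hold. The error `Σ_v̄ - Σ` of the
estimator and the residual `S - Σ_v̄` are orthogonal summands of `S - Σ`, hence bounded by it in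
Frobenius norm. -/
theorem posDef_of_quadraticForm_bounds
    {G₀ : Matrix (Fin p) (Fin p) ℝ} {G : Fin r → Matrix (Fin p) (Fin p) ℝ}
    (hG₀ : G₀.IsSymm) (hG : ∀ i, (G i).IsSymm) (hlin : LinearIndependent ℝ G)
    (horth : ∀ i, (G₀ * G i).trace = 0) {v : Fin r → ℝ} (hv : (modelCov G₀ G v).PosDef)
    {S : Matrix (Fin p) (Fin p) ℝ} (hS : S.IsSymm) {x : ℝ}
    (hx : x * (1 + condNumber (modelCov G₀ G v) * √p) = 1)
    (hlow : ∀ u, u ≠ 0 → (1 - x) * (u ⬝ᵥ modelCov G₀ G v *ᵥ u) < u ⬝ᵥ S *ᵥ u)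
    (hupp : ∀ u, u ⬝ᵥ S *ᵥ u ≤ (1 + x) * (u ⬝ᵥ modelCov G₀ G v *ᵥ u)) :
    (modelCov G₀ G (leastSquares G S)).PosDef ∧
      ((2 : ℝ) • S - modelCov G₀ G (leastSquares G S)).PosDef := by
  set M := modelCov G₀ G v with hM
  set N := modelCov G₀ G (leastSquares G S) with hN
  set L := spectralNorm M with hL
  set l := spectralNorm M⁻¹ with hl
  have hκ : condNumber M = l * L := rfl
  rw [hκ] at hx
  have hL0 : 0 ≤ L := norm_nonneg _
  have hl0 : 0 ≤ l := norm_nonneg _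
  have hx0 : 0 < x := by
    have h1 : 0 < 1 + l * L * √p := by positivity
    exact pos_of_mul_pos_left (by rw [hx]; exact one_pos) h1.le
  have hsymm : ∀ w, (modelCov G₀ G w).IsSymm := fun w => by
    unfold modelCov Matrix.IsSymm
    rw [Matrix.transpose_add, Matrix.transpose_sum, hG₀.eq]
    simp [(hG _).eq]
  rcases Nat.eq_zero_or_pos p with rfl | hp
  · have htriv : ∀ A : Matrix (Fin 0) (Fin 0) ℝ, A.PosDef := fun A =>
      Matrix.PosDef.of_dotProduct_mulVec_pos (Subsingleton.elim _ _) fun u hu =>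
        absurd (Subsingleton.elim u 0) hu
    exact ⟨htriv _, htriv _⟩
  have hq : ∀ u, u ≠ 0 → 0 < u ⬝ᵥ M *ᵥ u := fun u hu => by
    simpa using hv.dotProduct_mulVec_pos hu
  have hLpos : 0 < L := by
    rcases hL0.eq_or_lt with h | h
    · have h1 : (Pi.single ⟨0, hp⟩ 1 : Fin p → ℝ) ≠ 0 := by simp
      have h2 := hq _ h1
      have h3 := dotProduct_mulVec_le_spectralNorm M (Pi.single ⟨0, hp⟩ 1)
      rw [← hL, ← h, zero_mul] at h3
      linarith
    · exact h
  -- the sampling error and its Frobenius norm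
  have hE : ((S - M).vec ⬝ᵥ (S - M).vec) ≤ p * (x * L) ^ 2 := by
    refine frobenius_sq_le (hS.sub (hsymm v)) (by positivity) fun u => ?_
    have h1 := dotProduct_mulVec_le_spectralNorm M u
    have h2 : |u ⬝ᵥ (S - M) *ᵥ u| ≤ x * (u ⬝ᵥ M *ᵥ u) := by
      rw [Matrix.sub_mulVec, dotProduct_sub, abs_le]
      have h3 := hupp u
      rcases eq_or_ne u 0 with rfl | hu
      · simp
      · have h4 := hlow u hu
        constructor <;> nlinarith
    rw [mul_assoc]
    exact h2.trans (mul_le_mul_of_nonneg_left h1 hx0.le)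
  -- orthogonality of the estimation error and the residual
  have hG0j : ∀ j, (G j).vec ⬝ᵥ G₀.vec = 0 := fun j => by
    rw [dotProduct_comm, inner_vec_eq_trace _ _ hG₀, horth]
  have hnormal : ∀ j, (G j).vec ⬝ᵥ (S - N).vec = 0 := fun j => by
    rw [hN, modelCov, Matrix.vec_sub, Matrix.vec_add, dotProduct_sub, dotProduct_add, hG0j,
      vec_dotProduct_leastSquares hlin]
    ring
  have hD : N - M = ∑ i, (leastSquares G S i - v i) • G i := by
    rw [hN, hM, modelCov, modelCov, add_sub_add_left_eq_sub, ← Finset.sum_sub_distrib]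
    exact Finset.sum_congr rfl fun i _ => by rw [sub_smul]
  have hperp : (N - M).vec ⬝ᵥ (S - N).vec = 0 := by
    rw [hD, Matrix.vec_sum, sum_dotProduct]
    refine Finset.sum_eq_zero fun i _ => ?_
    rw [Matrix.vec_smul, smul_dotProduct, hnormal, smul_zero]
  have hpyth : (S - M).vec ⬝ᵥ (S - M).vec =
      (N - M).vec ⬝ᵥ (N - M).vec + (S - N).vec ⬝ᵥ (S - N).vec := by
    have : S - M = (N - M) + (S - N) := by abel
    rw [this, Matrix.vec_add, add_dotProduct, dotProduct_add, dotProduct_add, hperp,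
      dotProduct_comm (S - N).vec (N - M).vec, hperp]
    ring
  have hfrob : ∀ A : Matrix (Fin p) (Fin p) ℝ, A.vec ⬝ᵥ A.vec ≤ (S - M).vec ⬝ᵥ (S - M).vec →
      ∀ u, |u ⬝ᵥ A *ᵥ u| ≤ x * (l * L * √p) * (u ⬝ᵥ M *ᵥ u) := by
    intro A hA u
    refine (abs_dotProduct_mulVec_le_frobenius A u).trans ?_
    have h1 : √(A.vec ⬝ᵥ A.vec) ≤ √p * (x * L) := by
      refine Real.sqrt_le_iff.2 ⟨by positivity, (hA.trans hE).trans_eq ?_⟩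
      rw [mul_pow (√(p : ℝ)), Real.sq_sqrt (by positivity)]
    calc _ ≤ (√p * (x * L)) * (l * (u ⬝ᵥ M *ᵥ u)) :=
          mul_le_mul h1 (dotProduct_self_le_spectralNorm_inv hv u)
            (Finset.sum_nonneg fun i _ => mul_self_nonneg (u i)) (by positivity)
      _ = _ := by ring
  have hself : ∀ A : Matrix (Fin p) (Fin p) ℝ, 0 ≤ A.vec ⬝ᵥ A.vec := fun A =>
    Finset.sum_nonneg fun i _ => mul_self_nonneg (A.vec i)
  have hDb := hfrob (N - M) (by rw [hpyth]; linarith [hself (S - N)])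
  have hRb := hfrob (S - N) (by rw [hpyth]; linarith [hself (N - M)])
  have hxT : x * (l * L * √p) = 1 - x := by linarith
  rw [hxT] at hDb hRb
  have hherm : ∀ A : Matrix (Fin p) (Fin p) ℝ, A.IsSymm → A.IsHermitian := fun A hA => by
    rw [Matrix.IsHermitian, Matrix.conjTranspose_eq_transpose_of_trivial, hA.eq]
  constructor
  · refine Matrix.PosDef.of_dotProduct_mulVec_pos (hherm _ (hsymm _)) fun u hu => ?_
    have h1 := (abs_le.1 (hDb u)).1
    have h2 := hq u hu
    rw [Matrix.sub_mulVec, dotProduct_sub] at h1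
    simp only [star_trivial]
    nlinarith
  · refine Matrix.PosDef.of_dotProduct_mulVec_pos (hherm _ ((hS.smul _).sub (hsymm _)))
      fun u hu => ?_
    have h1 := (abs_le.1 (hRb u)).1
    have h2 := hlow u hu
    rw [Matrix.sub_mulVec, dotProduct_sub] at h1
    simp only [star_trivial, Matrix.sub_mulVec, dotProduct_sub, Matrix.smul_mulVec,
      dotProduct_smul, smul_eq_mul]
    linarith

end Deterministic

/-! ### Centering a sample -/

section Centering

/-- An orthogonal projection maps an orthonormal basis to a Parseval frame. -/
lemma isParsevalFrame_orthogonalProjectionOnto {ι E : Type*} [Fintype ι] [NormedAddCommGroup E]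
    [InnerProductSpace ℝ E] (b : OrthonormalBasis ι ℝ E) (K : Submodule ℝ E)
    [K.HasOrthogonalProjection] :
    IsParsevalFrame fun i => K.orthogonalProjectionOnto (b i) := by
  intro w w'
  simp only [Submodule.inner_orthogonalProjectionOnto_eq_of_mem_left]
  rw [Submodule.coe_inner, ← b.sum_inner_mul_inner]
  exact Finset.sum_congr rfl fun i _ => by rw [real_inner_comm (b i) (w' : E)]

/-- The space of vectors in `ℝⁿ` whose coordinates sum to zero. -/
noncomputable abbrev centeredSpace (n : ℕ) : Submodule ℝ (EuclideanSpace ℝ (Fin n)) :=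
  (ℝ ∙ (WithLp.toLp 2 fun _ => (1 : ℝ) : EuclideanSpace ℝ (Fin n)))ᗮ

/-- The Parseval frame of `centeredSpace n` obtained by projecting the standard basis of `ℝⁿ`. -/
noncomputable def centeringFrame (n : ℕ) (i : Fin n) : centeredSpace n :=
  (centeredSpace n).orthogonalProjectionOnto (EuclideanSpace.basisFun (Fin n) ℝ i)

lemma isParsevalFrame_centeringFrame (n : ℕ) : IsParsevalFrame (centeringFrame n) :=
  isParsevalFrame_orthogonalProjectionOnto (EuclideanSpace.basisFun (Fin n) ℝ) (centeredSpace n)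

lemma finrank_centeredSpace (n : ℕ) : Module.finrank ℝ (centeredSpace (n + 1)) = n := by
  have : Fact (Module.finrank ℝ (EuclideanSpace ℝ (Fin (n + 1))) = n + 1) := ⟨by simp⟩
  refine Submodule.finrank_orthogonal_span_singleton fun h => ?_
  have := congrArg (fun x : EuclideanSpace ℝ (Fin (n + 1)) => x 0) h
  simp at this

lemma norm_sq_sum_smul_centeringFrame {n : ℕ} (c : Fin n → ℝ) :
    ‖∑ i, c i • centeringFrame n i‖ ^ 2 = ∑ i, (c i - (n : ℝ)⁻¹ * ∑ j, c j) ^ 2 := by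
  have h1 : ∑ i, c i • centeringFrame n i =
      (centeredSpace n).orthogonalProjectionOnto (WithLp.toLp 2 c) := by
    have : (WithLp.toLp 2 c : EuclideanSpace ℝ (Fin n)) =
        ∑ i, c i • EuclideanSpace.basisFun (Fin n) ℝ i := by
      rw [← (EuclideanSpace.basisFun (Fin n) ℝ).sum_repr (WithLp.toLp 2 c)]
      simp
    rw [this, map_sum]
    exact Finset.sum_congr rfl fun i _ => by rw [map_smul]; rfl
  rw [h1, Submodule.coe_norm, Submodule.coe_orthogonalProjectionOnto_apply,
    Submodule.starProjection_orthogonal_val, Submodule.starProjection_singleton,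
    EuclideanSpace.real_norm_sq_eq]
  refine Finset.sum_congr rfl fun i _ => ?_
  have h2 : ‖(WithLp.toLp 2 fun _ => (1 : ℝ) : EuclideanSpace ℝ (Fin n))‖ ^ 2 = n := by
    rw [EuclideanSpace.real_norm_sq_eq]; simp
  rw [h2]
  simp [PiLp.inner_apply, div_eq_inv_mul]

lemma dotProduct_sampleCov_mulVec {n p : ℕ} (x : Fin n → EuclideanSpace ℝ (Fin p))
    (u : EuclideanSpace ℝ (Fin p)) :
    u.ofLp ⬝ᵥ sampleCov x *ᵥ u.ofLp =
      (n : ℝ)⁻¹ * ∑ i, (⟪x i, u⟫ - (n : ℝ)⁻¹ * ∑ j, ⟪x j, u⟫) ^ 2 := by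
  rw [sampleCov, Matrix.smul_mulVec, dotProduct_smul, smul_eq_mul, Matrix.sum_mulVec,
    dotProduct_sum]
  congr 1
  refine Finset.sum_congr rfl fun i _ => ?_
  have h : ⟪x i, u⟫ - (n : ℝ)⁻¹ * ∑ j, ⟪x j, u⟫ = u.ofLp ⬝ᵥ (x i - sampleMean x).ofLp := by
    rw [← sum_inner, ← real_inner_smul_left, ← inner_sub_left, EuclideanSpace.inner_eq_star_dotProduct]
    rfl
  rw [h, Matrix.vecMulVec_mulVec]
  simp [dotProduct_comm, sq]

lemma isSymm_sampleCov {n p : ℕ} (x : Fin n → EuclideanSpace ℝ (Fin p)) :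
    (sampleCov x).IsSymm := by
  rw [Matrix.IsSymm, sampleCov, Matrix.transpose_smul, Matrix.transpose_sum]
  simp only [Matrix.transpose_vecMulVec]

/-- For a sample that is an affine image `m + A z` of `z`, the quadratic form of the sample
covariance matrix is the squared norm of the value of the centering frame map of `z` at `A u`. -/
lemma dotProduct_sampleCov_affine {n p : ℕ} (hn : n ≠ 0) (m : EuclideanSpace ℝ (Fin p))
    (A : EuclideanSpace ℝ (Fin p) →L[ℝ] EuclideanSpace ℝ (Fin p))
    (hA : ∀ v w, ⟪A v, w⟫ = ⟪v, A w⟫) (z : Fin n → EuclideanSpace ℝ (Fin p))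
    (u : EuclideanSpace ℝ (Fin p)) :
    u.ofLp ⬝ᵥ sampleCov (fun i => m + A (z i)) *ᵥ u.ofLp =
      (n : ℝ)⁻¹ * ‖frameMap (centeringFrame n) (A u)
        (WithLp.toLp 2 fun ij : Fin n × Fin p => z ij.1 ij.2)‖ ^ 2 := by
  have hc : ∀ i, ∑ j, (A u) j * z i j = ⟪z i, A u⟫ := fun i => by
    simp [PiLp.inner_apply]
  have hn' : (n : ℝ) ≠ 0 := Nat.cast_ne_zero.2 hn
  rw [dotProduct_sampleCov_mulVec, frameMap_apply, norm_sq_sum_smul_centeringFrame]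
  congr 1
  refine Finset.sum_congr rfl fun i _ => ?_
  simp only [hc, inner_add_left, hA, Finset.sum_add_distrib, Finset.sum_const, Finset.card_univ,
    Fintype.card_fin, nsmul_eq_mul]
  congr 1
  field_simp
  ring

end Centering

/-! ### Joint law of independent standard Gaussian vectors -/

section Law

/-- Independent standard Gaussian vectors, joined into one long vector, are standard Gaussian. -/
lemma map_toLp_eq_stdGaussian {Ω ι κ : Type*} [Fintype ι] [Fintype κ] [MeasurableSpace Ω]
    {P : Measure Ω} [IsProbabilityMeasure P] {Z : ι → Ω → EuclideanSpace ℝ κ}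
    (hZ : ∀ i, AEMeasurable (Z i) P) (hind : iIndepFun Z P)
    (hlaw : ∀ i, P.map (Z i) = stdGaussian (EuclideanSpace ℝ κ)) :
    P.map (fun ω => (WithLp.toLp 2 fun ij : ι × κ => Z ij.1 ω ij.2 : EuclideanSpace ℝ (ι × κ))) =
      stdGaussian (EuclideanSpace ℝ (ι × κ)) := by
  have hm : AEMeasurable (fun ω => (WithLp.toLp 2 fun ij : ι × κ => Z ij.1 ω ij.2 :
      EuclideanSpace ℝ (ι × κ))) P := by
    refine (WithLp.measurable_toLp 2 _).comp_aemeasurable (aemeasurable_pi_lambda _ fun ij => ?_)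
    have : Measurable fun z : EuclideanSpace ℝ κ => z ij.2 := by fun_prop
    exact this.comp_aemeasurable (hZ ij.1)
  have hm' : AEMeasurable (fun ω => WithLp.toLp 2 (Z · ω)) P :=
    (WithLp.measurable_toLp 2 _).comp_aemeasurable (aemeasurable_pi_lambda _ hZ)
  have := Measure.isProbabilityMeasure_map (μ := P) hm
  refine Measure.ext_of_charFun (funext fun t => ?_)
  let s : PiLp 2 fun _ : ι => EuclideanSpace ℝ κ :=
    WithLp.toLp 2 fun i => WithLp.toLp 2 fun j => t (i, j)
  have h1 := (iIndepFun_iff_charFun_pi hZ).1 hind s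
  simp only [hlaw, charFun_stdGaussian] at h1
  rw [charFun_apply, integral_map hm' (by fun_prop)] at h1
  rw [charFun_apply, integral_map hm (by fun_prop), charFun_stdGaussian]
  refine Eq.trans ?_ (h1.trans ?_)
  · refine integral_congr_ae (.of_forall fun ω => ?_)
    simp only [PiLp.inner_apply, Fintype.sum_prod_type, s]
  · rw [← Complex.exp_sum]
    simp only [EuclideanSpace.norm_sq_eq, s, Fintype.sum_prod_type, ← Finset.sum_div,
      Finset.sum_neg_distrib, ← Complex.ofReal_pow, ← Complex.ofReal_sum]

end Law

/-! ### Whitening -/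

section Whitening

variable {p : ℕ}

open scoped MatrixOrder in
/-- For a positive definite `M`, the square root of `M` acts as an invertible self-adjoint
operator `A`, and `A z + m` is `N(m, M)` distributed for a standard Gaussian `z`. -/
lemma exists_whitening {M : Matrix (Fin p) (Fin p) ℝ} (hM : M.PosDef)
    (m : EuclideanSpace ℝ (Fin p)) :
    ∃ A B : EuclideanSpace ℝ (Fin p) →L[ℝ] EuclideanSpace ℝ (Fin p),
      (∀ v w, ⟪A v, w⟫ = ⟪v, A w⟫) ∧ (∀ v, A (B v) = v) ∧ (∀ v, B (A v) = v) ∧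
      (∀ u, ‖A u‖ ^ 2 = u.ofLp ⬝ᵥ M *ᵥ u.ofLp) ∧
      multivariateGaussian m M = (stdGaussian (EuclideanSpace ℝ (Fin p))).map fun z => m + A z := by
  have hsq : CFC.sqrt M * CFC.sqrt M = M := CFC.sqrt_mul_sqrt_self _ hM.posSemidef.nonneg
  have hdet : IsUnit (CFC.sqrt M).det := by
    have h := (Matrix.isUnit_iff_isUnit_det _).1 hM.isUnit
    rw [← hsq, Matrix.det_mul] at h
    exact isUnit_of_mul_isUnit_left h
  let A := Matrix.toEuclideanCLM (n := Fin p) (𝕜 := ℝ) (CFC.sqrt M)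
  let B := Matrix.toEuclideanCLM (n := Fin p) (𝕜 := ℝ) (CFC.sqrt M)⁻¹
  have hAsa : IsSelfAdjoint A := (CFC.sqrt_nonneg M).isSelfAdjoint.map _
  have hA : ∀ v w, ⟪A v, w⟫ = ⟪v, A w⟫ := fun v w => by
    conv_lhs => rw [← hAsa.adjoint_eq]
    rw [ContinuousLinearMap.adjoint_inner_left]
  refine ⟨A, B, hA, fun v => ?_, fun v => ?_, fun u => ?_, rfl⟩
  · change (A * B) v = v
    rw [← map_mul, Matrix.mul_nonsing_inv _ hdet, map_one, one_apply_eq_self]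
  · change (B * A) v = v
    rw [← map_mul, Matrix.nonsing_inv_mul _ hdet, map_one, one_apply_eq_self]
  · rw [← real_inner_self_eq_norm_sq, hA]
    change ⟪u, (A * A) u⟫ = _
    rw [← map_mul, hsq, Matrix.inner_toEuclideanCLM]

end Whitening

/-! ### The two numerical thresholds -/

section Numerics

variable {n p : ℕ} {T ε : ℝ}

lemma sqrt_natCast_mul_sqrt_div {n : ℕ} (hn : n ≠ 0) (y : ℝ) : √(n : ℝ) * √(y / n) = √y := by
  have hn' : (n : ℝ) ≠ 0 := Nat.cast_ne_zero.2 hn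
  rw [← Real.sqrt_mul (Nat.cast_nonneg n), mul_div_cancel₀ _ hn']

lemma sqrt_add_sqrt_add_eq (hn : n ≠ 0)
    (hε : ε = √((2 + T) / (1 + T)) - √(((n : ℝ) - 1) / n) - √((p : ℝ) / n)) (hT : 0 ≤ T) :
    √((n : ℝ) - 1) + √p + √n * ε = √n * √(1 + (1 + T)⁻¹) := by
  have h : (2 + T) / (1 + T) = 1 + (1 + T)⁻¹ := by field_simp; ring
  rw [hε, mul_sub, mul_sub, sqrt_natCast_mul_sqrt_div hn, sqrt_natCast_mul_sqrt_div hn, h]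
  ring

/-- Positivity of `ε` forces `(1 + T)⁻² > (4 / n) (1 - 1 / n)`, and this is
`√(1 + (1 + T)⁻¹) + √(1 - (1 + T)⁻¹) < 2 √(1 - 1 / n)`. -/
lemma sqrt_mul_sqrt_lt (hn : 2 ≤ n) (hp : 1 ≤ p)
    (hε : ε = √((2 + T) / (1 + T)) - √(((n : ℝ) - 1) / n) - √((p : ℝ) / n)) (hT : 0 ≤ T)
    (hpos : 0 < ε) :
    √n * √(1 - (1 + T)⁻¹) < √((n : ℝ) - 1) - √p - √n * ε := by
  have hn0 : n ≠ 0 := by omega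
  have hn2 : (2 : ℝ) ≤ n := by exact_mod_cast hn
  have hp1 : (1 : ℝ) ≤ p := by exact_mod_cast hp
  have hE := sqrt_add_sqrt_add_eq hn0 hε hT
  have hx0 : 0 < (1 + T)⁻¹ := by positivity
  have hx1 : (1 + T)⁻¹ ≤ 1 := inv_le_one_of_one_le₀ (by linarith)
  set x := (1 + T)⁻¹
  have hN : 0 ≤ (n : ℝ) - 1 := by linarith
  have ha := Real.sq_sqrt (show 0 ≤ 1 + x by linarith)
  have hb := Real.sq_sqrt (show 0 ≤ 1 - x by linarith)
  have hc := Real.sq_sqrt hN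
  have hd := Real.sq_sqrt (show (0 : ℝ) ≤ p by positivity)
  have hs := Real.sq_sqrt (show (0 : ℝ) ≤ n by positivity)
  have ha0 := Real.sqrt_nonneg (1 + x)
  have hb0 := Real.sqrt_nonneg (1 - x)
  have hc0 := Real.sqrt_nonneg ((n : ℝ) - 1)
  have hd0 : 1 ≤ √(p : ℝ) := Real.one_le_sqrt.2 hp1
  have hs0 : 0 < √(n : ℝ) := Real.sqrt_pos.2 (by linarith)
  have hse : 0 < √(n : ℝ) * ε := mul_pos hs0 hpos
  set a := √(1 + x)
  set b := √(1 - x)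
  set c := √((n : ℝ) - 1)
  set d := √(p : ℝ)
  set s := √(n : ℝ)
  have h1 : c + 1 < s * a := by linarith
  have h2 : 2 * c < n * x := by
    have : (c + 1) ^ 2 < (s * a) ^ 2 := by gcongr
    rw [mul_pow, hs, ha] at this
    nlinarith
  have h4 : n * (a * b) < n - 2 := by
    refine lt_of_pow_lt_pow_left₀ 2 (by linarith) ?_
    have h4 : (2 * c) ^ 2 < (n * x) ^ 2 := by gcongr
    have h5 : (n * (a * b)) ^ 2 = n ^ 2 - (n * x) ^ 2 := by
      rw [mul_pow, mul_pow, ha, hb]; ring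
    rw [h5]
    rw [mul_pow, hc] at h4
    linarith
  have h5 : s * (a + b) < 2 * c := by
    refine lt_of_pow_lt_pow_left₀ 2 (by linarith) ?_
    have : (s * (a + b)) ^ 2 = 2 * n + 2 * (n * (a * b)) := by
      rw [mul_pow, hs, add_sq, ha, hb]; ring
    rw [this, mul_pow, hc]
    linarith
  linarith

end Numerics

lemma one_sub_sub_le_measureReal {Ω : Type*} [MeasurableSpace Ω] {P : Measure Ω}
    [IsProbabilityMeasure P] {A B₁ B₂ : Set Ω} (h : ∀ ω, ω ∉ B₁ → ω ∉ B₂ → ω ∈ A) :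
    1 - P.real B₁ - P.real B₂ ≤ P.real A := by
  have h1 : (Set.univ : Set Ω) ⊆ A ∪ (B₁ ∪ B₂) := fun ω _ => by
    by_cases h1 : ω ∈ B₁
    · exact Or.inr (Or.inl h1)
    by_cases h2 : ω ∈ B₂
    · exact Or.inr (Or.inr h2)
    exact Or.inl (h ω h1 h2)
  have h2 := measureReal_mono (μ := P) h1
  rw [probReal_univ] at h2
  linarith [measureReal_union_le (μ := P) A (B₁ ∪ B₂), measureReal_union_le (μ := P) B₁ B₂]

/-! ### The deterministic conclusion -/

section Conclusion

lemma frameMap_smul_left {V ι κ : Type*} [NormedAddCommGroup V] [InnerProductSpace ℝ V]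
    [Fintype ι] [Fintype κ] (q : ι → V) (a : ℝ) (u : EuclideanSpace ℝ κ)
    (x : EuclideanSpace ℝ (ι × κ)) : frameMap q (a • u) x = a • frameMap q u x := by
  simp only [frameMap_apply, Finset.smul_sum, PiLp.smul_apply, smul_eq_mul, mul_assoc, ← smul_smul,
    ← Finset.mul_sum]

/-- The deterministic part of the argument: uniform two-sided bounds for the centering frame map
on unit vectors make both matrices positive definite. -/
lemma posDef_of_norm_frameMap_bounds {n p r : ℕ} (hn : 2 ≤ n)
    {G₀ : Matrix (Fin p) (Fin p) ℝ} {G : Fin r → Matrix (Fin p) (Fin p) ℝ}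
    (hG₀ : G₀.IsSymm) (hG : ∀ i, (G i).IsSymm) (hlin : LinearIndependent ℝ G)
    (horth : ∀ i, (G₀ * G i).trace = 0) {v : Fin r → ℝ} (hv : (modelCov G₀ G v).PosDef)
    {m : EuclideanSpace ℝ (Fin p)}
    {A : EuclideanSpace ℝ (Fin p) →L[ℝ] EuclideanSpace ℝ (Fin p)}
    (hA : ∀ v w, ⟪A v, w⟫ = ⟪v, A w⟫)
    (hAv : ∀ u, ‖A u‖ ^ 2 = u.ofLp ⬝ᵥ modelCov G₀ G v *ᵥ u.ofLp)
    {z : Fin n → EuclideanSpace ℝ (Fin p)} {ε : ℝ}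
    (hε : ε = epsBound n p (condNumber (modelCov G₀ G v))) (hpos : 0 < ε)
    (hupp : ∀ u : EuclideanSpace ℝ (Fin p), ‖u‖ = 1 → ‖frameMap (centeringFrame n) u
      (WithLp.toLp 2 fun ij : Fin n × Fin p => z ij.1 ij.2)‖ ≤ √((n : ℝ) - 1) + √p + √n * ε)
    (hlow : ∀ u : EuclideanSpace ℝ (Fin p), ‖u‖ = 1 → √((n : ℝ) - 1) - √p - √n * ε ≤
      ‖frameMap (centeringFrame n) u (WithLp.toLp 2 fun ij : Fin n × Fin p => z ij.1 ij.2)‖) :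
    (modelCov G₀ G (leastSquares G (sampleCov fun i => m + A (z i)))).PosDef ∧
      ((2 : ℝ) • sampleCov (fun i => m + A (z i)) -
        modelCov G₀ G (leastSquares G (sampleCov fun i => m + A (z i)))).PosDef := by
  set T := condNumber (modelCov G₀ G v) * √(p : ℝ) with hTdef
  have hT : 0 ≤ T :=
    mul_nonneg (mul_nonneg (norm_nonneg _) (norm_nonneg _)) (Real.sqrt_nonneg _)
  have hx1 : (1 + T)⁻¹ ≤ 1 := inv_le_one_of_one_le₀ (by linarith)
  have hx0 : 0 < (1 + T)⁻¹ := by positivity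
  have hn0 : n ≠ 0 := by omega
  have hnpos : (0 : ℝ) < n := by positivity
  set y : EuclideanSpace ℝ (Fin n × Fin p) := WithLp.toLp 2 fun ij => z ij.1 ij.2 with hy
  have hscale : ∀ w : EuclideanSpace ℝ (Fin p), w ≠ 0 →
      ‖(‖w‖⁻¹ • w)‖ = 1 ∧ ‖frameMap (centeringFrame n) w y‖ =
        ‖w‖ * ‖frameMap (centeringFrame n) (‖w‖⁻¹ • w) y‖ := fun w hw => by
    have hw' := norm_pos_iff.2 hw
    refine ⟨by rw [norm_smul, norm_inv, norm_norm, inv_mul_cancel₀ hw'.ne'], ?_⟩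
    rw [frameMap_smul_left, norm_smul, norm_inv, norm_norm, mul_inv_cancel_left₀ hw'.ne']
  have hquad := dotProduct_sampleCov_affine hn0 m A hA z
  refine posDef_of_quadraticForm_bounds hG₀ hG hlin horth hv (isSymm_sampleCov _)
    (x := (1 + T)⁻¹) (inv_mul_cancel₀ (by positivity)) (fun u hu => ?_) (fun u => ?_)
  · have hu' : (WithLp.toLp 2 u : EuclideanSpace ℝ (Fin p)) ≠ 0 := fun h =>
      hu (congrArg WithLp.ofLp h)
    have hp : 1 ≤ p := by
      obtain ⟨i, -⟩ := Function.ne_iff.1 hu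
      exact i.pos
    have hw : A (WithLp.toLp 2 u) ≠ 0 := fun h => by
      have h1 := hAv (WithLp.toLp 2 u)
      have h2 := hv.dotProduct_mulVec_pos hu
      rw [h, norm_zero] at h1
      simp only [star_trivial] at h2
      simp only at h1
      linarith
    have h1 := hquad (WithLp.toLp 2 u)
    have h2 := hAv (WithLp.toLp 2 u)
    simp only at h1 h2
    rw [h1, ← h2, ← hy]
    set w := A (WithLp.toLp 2 u)
    obtain ⟨h3, h4⟩ := hscale w hw
    have h5 := (sqrt_mul_sqrt_lt hn hp hε hT hpos).trans_le (hlow _ h3)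
    have h6 : (n : ℝ) * (1 - (1 + T)⁻¹) < ‖frameMap (centeringFrame n) (‖w‖⁻¹ • w) y‖ ^ 2 := by
      have := pow_lt_pow_left₀ h5 (by positivity) two_ne_zero
      rwa [mul_pow, Real.sq_sqrt hnpos.le, Real.sq_sqrt (by linarith)] at this
    have hw2 : 0 < ‖w‖ ^ 2 := by have := norm_pos_iff.2 hw; positivity
    rw [h4, mul_pow, lt_inv_mul_iff₀ hnpos]
    linarith [mul_lt_mul_of_pos_left h6 hw2]
  · have h1 := hquad (WithLp.toLp 2 u)
    have h2 := hAv (WithLp.toLp 2 u)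
    simp only at h1 h2
    rw [h1, ← h2, ← hy]
    set w := A (WithLp.toLp 2 u)
    rw [inv_mul_le_iff₀ hnpos]
    rcases eq_or_ne w 0 with hw | hw
    · rw [hw, show (0 : EuclideanSpace ℝ (Fin p)) = (0 : ℝ) • 0 by simp, frameMap_smul_left]
      simp
    obtain ⟨h3, h4⟩ := hscale w hw
    have h5 := (hupp _ h3).trans_eq (sqrt_add_sqrt_add_eq hn0 hε hT)
    have h6 : ‖frameMap (centeringFrame n) (‖w‖⁻¹ • w) y‖ ^ 2 ≤ (n : ℝ) * (1 + (1 + T)⁻¹) := by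
      have := pow_le_pow_left₀ (norm_nonneg _) h5 2
      rwa [mul_pow, Real.sq_sqrt hnpos.le, Real.sq_sqrt (by linarith)] at this
    rw [h4, mul_pow]
    linarith [mul_le_mul_of_nonneg_left h6 (sq_nonneg ‖w‖)]

end Conclusion

end LinearGaussianCov

open LinearGaussianCov

theorem mainTheorem4 {p r n : ℕ}
    (G₀ : Matrix (Fin p) (Fin p) ℝ) (G : Fin r → Matrix (Fin p) (Fin p) ℝ)
    (hG₀ : G₀.IsSymm) (hG : ∀ i, (G i).IsSymm)
    (hlin : LinearIndependent ℝ G)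
    (horth : ∀ i, (G₀ * G i).trace = 0)
    (vstar : Fin r → ℝ) (hvstar : vstar ∈ LinearGaussianCov.paramSpace G₀ G)
    (m : EuclideanSpace ℝ (Fin p))
    {Ω : Type*} [MeasurableSpace Ω] (P : Measure Ω) [IsProbabilityMeasure P]
    (X : Fin n → Ω → EuclideanSpace ℝ (Fin p))
    (hlaw : ∀ i, HasLaw (X i)
      (multivariateGaussian m (LinearGaussianCov.modelCov G₀ G vstar)) P)
    (hindep : iIndepFun X P)
    (S : Ω → Matrix (Fin p) (Fin p) ℝ)
    (hS : ∀ ω, S ω = LinearGaussianCov.sampleCov fun i => X i ω)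
    (vbar : Ω → Fin r → ℝ)
    (hvbar : ∀ ω, vbar ω = LinearGaussianCov.leastSquares G (S ω))
    (ε : ℝ)
    (hε : ε = LinearGaussianCov.epsBound n p
      (LinearGaussianCov.condNumber (LinearGaussianCov.modelCov G₀ G vstar)))
    (hn : 15 ≤ n) (hεpos : 0 < ε) :
    1 - 2 * Real.exp (-((n : ℝ) * ε ^ 2 / 2)) ≤
        P.real {ω | ((2 : ℝ) • S ω - LinearGaussianCov.modelCov G₀ G (vbar ω)).PosDef} ∧
      1 - 2 * Real.exp (-((n : ℝ) * ε ^ 2 / 2)) ≤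
        P.real {ω | (LinearGaussianCov.modelCov G₀ G (vbar ω)).PosDef} ∧
      1 - 4 * Real.exp (-((n : ℝ) * ε ^ 2 / 2)) ≤
        P.real {ω | vbar ω ∈ LinearGaussianCov.convexRegion G₀ G (S ω)} := by
  have hsq : (√(n : ℝ) * ε) ^ 2 = n * ε ^ 2 := by
    rw [mul_pow, Real.sq_sqrt (Nat.cast_nonneg n)]
  have ht0 : 0 < √(n : ℝ) * ε := by positivity
  -- it suffices to bound the probability that both matrices are positive definite
  suffices h : 1 - 2 * Real.exp (-((n : ℝ) * ε ^ 2 / 2)) ≤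
      P.real {ω | (modelCov G₀ G (vbar ω)).PosDef ∧
        ((2 : ℝ) • S ω - modelCov G₀ G (vbar ω)).PosDef} by
    refine ⟨h.trans (measureReal_mono fun ω hω => hω.2), h.trans (measureReal_mono fun ω hω => hω.1),
      le_trans ?_ (h.trans (measureReal_mono fun ω hω => ⟨hω.1, hω.1, hω.2⟩))⟩
    linarith [Real.exp_pos (-((n : ℝ) * ε ^ 2 / 2))]
  -- the bound is trivial unless `√n ε ≥ 1`, since `2 exp (-1/2) > 1`
  rcases lt_or_ge (√(n : ℝ) * ε) 1 with ht | ht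
  · refine le_trans ?_ measureReal_nonneg
    have h1 : (n : ℝ) * ε ^ 2 < 1 := by
      rw [← hsq]
      exact pow_lt_one₀ ht0.le ht two_ne_zero
    linarith [Real.add_one_le_exp (-((n : ℝ) * ε ^ 2 / 2))]
  obtain ⟨A, B, hA, hAB, hBA, hAM, hmG⟩ := exists_whitening hvstar m
  -- the whitened sample
  let Z : Fin n → Ω → EuclideanSpace ℝ (Fin p) := fun i ω => B (X i ω - m)
  have hBm : Measurable fun x : EuclideanSpace ℝ (Fin p) => B (x - m) := by fun_prop
  have hXZ : ∀ i ω, X i ω = m + A (Z i ω) := fun i ω => by simp [Z, hAB]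
  have hZ : ∀ i, AEMeasurable (Z i) P := fun i => hBm.comp_aemeasurable (hlaw i).aemeasurable
  have hZind : iIndepFun Z P := hindep.comp (fun _ x => B (x - m)) fun _ => hBm
  have hZlaw : ∀ i, P.map (Z i) = stdGaussian (EuclideanSpace ℝ (Fin p)) := fun i => by
    have h1 : P.map (Z i) = (P.map (X i)).map fun x => B (x - m) :=
      (AEMeasurable.map_map_of_aemeasurable hBm.aemeasurable (hlaw i).aemeasurable).symm
    have h2 : (fun x => B (x - m)) ∘ (fun z => m + A z) = id := by
      ext1 z
      simp [hBA]
    rw [h1, (hlaw i).map_eq, hmG, Measure.map_map hBm (by fun_prop), h2, Measure.map_id]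
  let Y : Ω → EuclideanSpace ℝ (Fin n × Fin p) := fun ω =>
    WithLp.toLp 2 fun ij => Z ij.1 ω ij.2
  have hYlaw : P.map Y = stdGaussian (EuclideanSpace ℝ (Fin n × Fin p)) :=
    map_toLp_eq_stdGaussian hZ hZind hZlaw
  have hY : AEMeasurable Y P := AEMeasurable.of_map_ne_zero (by
    rw [hYlaw]; exact IsProbabilityMeasure.ne_zero _)
  have hpre : ∀ s, P.real (Y ⁻¹' s) ≤ (stdGaussian (EuclideanSpace ℝ (Fin n × Fin p))).real s :=
    fun s => by
      rw [← hYlaw]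
      have := Measure.isProbabilityMeasure_map hY
      exact ENNReal.toReal_mono (measure_ne_top _ _) (Measure.le_map_apply hY s)
  obtain ⟨N, rfl⟩ : ∃ N, n = N + 1 := ⟨n - 1, by omega⟩
  have hN : (((N + 1 : ℕ) : ℝ) - 1) = N := by push_cast; ring
  have hdim := finrank_centeredSpace N
  have hframe := isParsevalFrame_centeringFrame (N + 1)
  have hup := measureReal_exists_lt_norm_frameMap_le (κ := Fin p) hframe ht0
  have hlo := measureReal_exists_norm_frameMap_lt_le (κ := Fin p) hframe (by omega) ht
  rw [hsq, hdim, Fintype.card_fin] at hup hlo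
  refine le_trans ?_ (one_sub_sub_le_measureReal
    (B₁ := Y ⁻¹' {x | ∃ u : EuclideanSpace ℝ (Fin p), ‖u‖ = 1 ∧
      √(N : ℝ) + √(p : ℝ) + √((N + 1 : ℕ) : ℝ) * ε < ‖frameMap (centeringFrame (N + 1)) u x‖})
    (B₂ := Y ⁻¹' {x | ∃ u : EuclideanSpace ℝ (Fin p), ‖u‖ = 1 ∧
      ‖frameMap (centeringFrame (N + 1)) u x‖ < √(N : ℝ) - √(p : ℝ) - √((N + 1 : ℕ) : ℝ) * ε})
    (fun ω h₁ h₂ => ?_))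
  · linarith [(hpre _).trans hup, (hpre _).trans hlo]
  · have hSω : S ω = sampleCov fun i => m + A (Z i ω) := by
      rw [hS]
      simp only [← hXZ]
    simp only [Set.mem_ofPred_eq, hvbar, hSω]
    refine posDef_of_norm_frameMap_bounds (by omega) hG₀ hG hlin horth hvstar hA hAM hε hεpos
      (fun u hu => ?_) (fun u hu => ?_)
    · rw [hN]
      exact not_lt.1 fun h => h₁ ⟨u, hu, h⟩
    · rw [hN]
      exact not_lt.1 fun h => h₂ ⟨u, hu, h⟩
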